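/- Let $d\ge 2$, $\lambda_S>0$, and let $X_S$ be a homogeneous Poisson point process in $\mathbb{R}^d$ with intensity $\lambda_S$. Let $S$ be the Poisson-Voronoi tessellation generated by $X_S$; call its $1$-facets streets and its $0$-facets crossroads, and let $\Lambda$ be the random measure giving the total street length (one-dimensional Hausdorff measure) in a Borel set. Given $S$, let the users $X^{\lambda}$ be a Poisson point process with mean measure $\lambda\Lambda$, $\lambda>0$ (a Cox process), and let the relays $Y$ be obtained by keeping each crossroad independently with probability $p\in[0,1]$, with $X^\lambda$ and $Y$ conditionally independent given $S$. The connectivity graph $\mathcal{G}$ has vertex set $X^{\lambda}\cup Y$, and two distinct vertices are joined by an edge if and only if they lie on a common street and their Euclidean distance is at most $r$, where $0<r<\infty$. The graph $\mathcal{G}$ percolates if it has an infinite connected component. Let $\bar l$ be the mean length of the typical street of $S$, that is, for any Borel window $W$ of positive finite volume, the expected total length of the streets with midpoint in $W$ divided by the expected number of such streets. Put $U=\lambda\bar l$, $H=\bar l/r$, and let $P(p,U,H)$ be the probability that $\mathcal{G}$ percolates. **Theorem (Existence of sub-critical intensities of users).** For every $d\ge 2$ there exist $H_0\in(0,\infty)$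 and $U_0\in(0,\infty)$, depending only on $d$, such that $P(p,U,H)=0$ for all $H\in[H_0,\infty)$, all $U\in(0,U_0]$ and all $p\in[0,1]$ (in particular $P(1,U,H)=0$), whatever the value of $\lambda_S>0$. -/

import Mathlib

open MeasureTheory ProbabilityTheory
open scoped ENNReal

namespace VoronoiPercolation

/-- Euclidean space of dimension `d`. -/
abbrev Space (d : ℕ) : Type := EuclideanSpace ℝ (Fin d)

/-- Locally finite point configurations in `ℝ^d`. -/
structure Config (d : ℕ) where
  /-- the set of points -/
  carrier : Set (Space d)
  locallyFinite : ∀ B : Set (Space d), Bornology.IsBounded B → (carrier ∩ B).Finite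

/-- The number of points of a configuration in a set. -/
noncomputable def Config.count {d : ℕ} (ξ : Config d) (B : Set (Space d)) : ℕ∞ :=
  (ξ.carrier ∩ B).encard

/-- The evaluation `σ`-algebra: the smallest one making all counts of Borel sets measurable. -/
noncomputable instance (d : ℕ) : MeasurableSpace (Config d) :=
  ⨆ (B : Set (Space d)) (_ : MeasurableSet B),
    MeasurableSpace.comap (fun ξ : Config d => ξ.count B) ⊤

/-! ### The Voronoi tessellation -/

/-- The closed Voronoi cell of the nucleus `x` in the configuration `ξ`. -/
def cell {d : ℕ} (ξ : Config d) (x : Space d) : Set (Space d) :=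
  {y | ∀ x' ∈ ξ.carrier, dist y x ≤ dist y x'}

/-- The faces of the Voronoi tessellation: the nonempty intersections of cells. -/
def faces {d : ℕ} (ξ : Config d) : Set (Set (Space d)) :=
  {f | f.Nonempty ∧ ∃ N : Set (Space d), N ⊆ ξ.carrier ∧ N.Nonempty ∧ f = ⋂ x ∈ N, cell ξ x}

/-- Streets (`1`-facets): the faces of dimension one. -/
def streets {d : ℕ} (ξ : Config d) : Set (Set (Space d)) :=
  {e | e ∈ faces ξ ∧ Module.finrank ℝ (vectorSpan ℝ e) = 1}

/-- Crossroads (`0`-facets): the faces that consist of one point. -/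
def crossroads {d : ℕ} (ξ : Config d) : Set (Space d) :=
  {v | {v} ∈ faces ξ}

/-- The edge-length measure `Λ(B) = ν₁(S ∩ B)`, where `ν₁` is the one-dimensional Hausdorff
measure and `S` is the union of all streets. -/
noncomputable def streetMeasure {d : ℕ} (ξ : Config d) : Measure (Space d) :=
  (Measure.hausdorffMeasure 1).restrict (⋃₀ streets ξ)

/-! ### Mean length of the typical street -/

/-- The (bounded) streets whose midpoint lies in the window `W`. -/
def streetsCenteredIn {d : ℕ} (ξ : Config d) (W : Set (Space d)) : Set (Set (Space d)) :=
  {e | e ∈ streets ξ ∧ ∃ a b : Space d, e = segment ℝ a b ∧ midpoint ℝ a b ∈ W}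

/-- The mean length of the typical street seen through the window `W`, when `Q` is the law of the
nuclei: expected total length of the streets centered in `W`, divided by their expected number. -/
noncomputable def meanStreetLengthIn {d : ℕ} (Q : Measure (Config d)) (W : Set (Space d)) :
    ℝ≥0∞ :=
  (∫⁻ ξ, ∑' e : streetsCenteredIn ξ W, Measure.hausdorffMeasure 1 (e : Set (Space d)) ∂Q) /
    (∫⁻ ξ, ((streetsCenteredIn ξ W).encard : ℝ≥0∞) ∂Q)

/-- The mean length of the typical street of the Poisson-Voronoi tessellation whose nuclei have
intensity `lamS` and law `Q`. By stationarity every window of positive finite volume gives the same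
value; the window used here is a cube that contains one nucleus on average. -/
noncomputable def meanStreetLength {d : ℕ} (lamS : ℝ) (Q : Measure (Config d)) : ℝ :=
  (meanStreetLengthIn Q {y | ∀ i, y i ∈ Set.Icc (0 : ℝ) (lamS ^ (-(1 : ℝ) / d))}).toReal

/-! ### The point processes -/

/-- Probability of the value `n` under the Poisson law of mean `a`. -/
noncomputable def poissonWeight (a : ℝ) (n : ℕ) : ℝ :=
  Real.exp (-a) * a ^ n / n.factorial

/-- Probability of the value `m` under the binomial law with `k` trials and success
probability `p`. -/
noncomputable def binomialWeight (k : ℕ) (p : ℝ) (m : ℕ) : ℝ :=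
  (k.choose m : ℝ) * p ^ m * (1 - p) ^ (k - m)

/-- `X` is a homogeneous Poisson point process of intensity `lamS`: the numbers of points in
disjoint bounded Borel sets are independent and Poisson distributed, with mean `lamS` times the
volume. -/
structure IsPoissonProcess {Ω : Type*} [MeasurableSpace Ω] (P : Measure Ω) {d : ℕ} (lamS : ℝ)
    (X : Ω → Config d) : Prop where
  measurable : Measurable X
  law : ∀ (k : ℕ) (B : Fin k → Set (Space d)) (n : Fin k → ℕ),
    (∀ i, MeasurableSet (B i)) → (∀ i, Bornology.IsBounded (B i)) →
    Pairwise (Function.onFun Disjoint B) →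
    P {ω | ∀ i, (X ω).count (B i) = n i} =
      ENNReal.ofReal (∏ i, poissonWeight (lamS * (volume (B i)).toReal) (n i))

/-- The network model: nuclei `XS`, users `X` and relays `Y`.
The nuclei form a homogeneous Poisson process of intensity `lamS`. Conditionally on the
tessellation, the users form a Poisson process with mean measure `lam • Λ`, the relays are obtained
by keeping every crossroad independently with probability `p`, and users and relays are
independent. -/
structure IsNetwork {Ω : Type*} [MeasurableSpace Ω] (P : Measure Ω) {d : ℕ} (lamS lam p : ℝ)
    (XS X Y : Ω → Config d) : Prop where
  nuclei : IsPoissonProcess P lamS XS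
  measurable_users : Measurable X
  measurable_relays : Measurable Y
  relays_subset : ∀ᵐ ω ∂P, (Y ω).carrier ⊆ crossroads (XS ω)
  conditional_law : ∀ (k l : ℕ) (B : Fin k → Set (Space d)) (n : Fin k → ℕ)
    (C : Fin l → Set (Space d)) (m : Fin l → ℕ),
    (∀ i, MeasurableSet (B i)) → (∀ i, Bornology.IsBounded (B i)) →
    Pairwise (Function.onFun Disjoint B) →
    (∀ j, MeasurableSet (C j)) → (∀ j, Bornology.IsBounded (C j)) →
    Pairwise (Function.onFun Disjoint C) →
    P⟦{ω | (∀ i, (X ω).count (B i) = n i) ∧ ∀ j, (Y ω).count (C j) = m j} |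
        MeasurableSpace.comap XS inferInstance⟧
      =ᵐ[P] fun ω =>
        (∏ i, poissonWeight (lam * (streetMeasure (XS ω) (B i)).toReal) (n i)) *
          ∏ j, binomialWeight (crossroads (XS ω) ∩ C j).ncard p (m j)

/-! ### The connectivity graph -/

/-- The connectivity graph: the vertices are the users and the relays, and two distinct vertices are
adjacent when they lie on a common street and at Euclidean distance at most `r`. -/
def connectivityGraph {d : ℕ} (ξ users relays : Config d) (r : ℝ) :
    SimpleGraph ↥(users.carrier ∪ relays.carrier) where
  Adj a b := a ≠ b ∧ (∃ e ∈ streets ξ, (a : Space d) ∈ e ∧ (b : Space d) ∈ e) ∧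
    dist (a : Space d) (b : Space d) ≤ r
  symm := ⟨fun a b h => ⟨h.1.symm,
    let ⟨e, he, ha, hb⟩ := h.2.1
    ⟨e, he, hb, ha⟩, by rw [dist_comm]; exact h.2.2⟩⟩
  loopless := ⟨fun a h => h.1 rfl⟩

/-- A graph percolates when it has an infinite connected component. -/
def Percolates {V : Type*} (G : SimpleGraph V) : Prop :=
  ∃ c : G.ConnectedComponent, c.supp.Infinite

end VoronoiPercolation

namespace VoronoiPercolation

/-! ### Void events and the law of a Poisson process -/

/-! The proof is a Peierls argument on unit cubes, uniform in `p` because relays are used only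
through the fact that they are crossroads. A similarity first brings the intensity of nuclei to a
value `μ` fixed in advance. It preserves `U` and `H`, so thresholds found at intensity `μ` serve
every `lamS`.

Call a cube bad if the nuclei near it are atypical (an empty neighbouring cube, too many points, or
two distinct circumcenters closer than `ρ`), or if a user lies in the cube or a cube touching it.
Suppose that a vertex in a good cube has a neighbour. Both endpoints are then relays, hence distinct
crossroads near the cube, hence at least `ρ` apart, which is impossible when `r < ρ`. So every
non-isolated vertex sits in a bad cube (`badCube_of_adj`), and an infinite component produces
arbitrarily long chains of well separated bad cubes (`exists_separated_chain`).

Atypical nuclei are a local event, so they are independent for separated cubes, with probability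
made small by choosing `μ`, then `M`, then `ρ` (`exists_badNuclei_bound`). Where the nuclei are
typical the street length is at most a constant `L`, so given the nuclei a user is present with
probability at most `lam * L`, independently over disjoint blocks (`measure_users_le`). Together
these bound the probability of a given separated chain by a power of a small number
(`measure_badCubes_le`), which beats the exponential number of chains
(`measure_percolates_eq_zero`). -/

theorem count_eq_zero {d : ℕ} {ξ : Config d} {B : Set (Space d)} :
    ξ.count B = 0 ↔ ∀ x ∈ ξ.carrier, x ∉ B := by
  rw [Config.count, Set.encard_eq_zero, Set.eq_empty_iff_forall_notMem]
  exact forall_congr' fun x => by simp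

theorem count_ne_zero {d : ℕ} {ξ : Config d} {B : Set (Space d)} :
    ξ.count B ≠ 0 ↔ ∃ x ∈ ξ.carrier, x ∈ B := by
  rw [Ne, count_eq_zero]; push Not; rfl

/-- The event that a configuration has no point in `B`. -/
def void {d : ℕ} (B : Set (Space d)) : Set (Config d) := {ξ | ξ.count B = 0}

/-- The void events of the bounded Borel subsets of `W`. -/
def voids {d : ℕ} (W : Set (Space d)) : Set (Set (Config d)) :=
  {E | ∃ B, MeasurableSet B ∧ Bornology.IsBounded B ∧ B ⊆ W ∧ E = void B}

/-- The `σ`-algebra generated by the void events of the bounded Borel subsets of `W`. -/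
abbrev voidAlgebra {d : ℕ} (W : Set (Space d)) : MeasurableSpace (Config d) :=
  MeasurableSpace.generateFrom (voids W)

theorem void_inter {d : ℕ} (B C : Set (Space d)) : void B ∩ void C = void (B ∪ C) := by
  ext ξ
  simp only [void, Set.mem_inter_iff, Set.mem_ofPred_eq, count_eq_zero, Set.mem_union, not_or]
  exact ⟨fun h x hx => ⟨h.1 x hx, h.2 x hx⟩, fun h => ⟨fun x hx => (h x hx).1,
    fun x hx => (h x hx).2⟩⟩

theorem void_iInter {d : ℕ} {ι : Type*} (B : ι → Set (Space d)) (s : Finset ι) :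
    ⋂ i ∈ s, void (B i) = void (⋃ i ∈ s, B i) := by
  ext ξ
  simp only [void, Set.mem_iInter, Set.mem_ofPred_eq, count_eq_zero, Set.mem_iUnion, not_exists]
  exact ⟨fun h x hx i hi => h i hi x hx, fun h i hi x hx => h x hx i hi⟩

theorem isPiSystem_voids {d : ℕ} (W : Set (Space d)) : IsPiSystem (voids W) := by
  rintro _ ⟨B, hB, hb, hW, rfl⟩ _ ⟨C, hC, hc, hW', rfl⟩ -
  exact ⟨B ∪ C, hB.union hC, hb.union hc, Set.union_subset hW hW', void_inter B C⟩

theorem measurableSet_void {d : ℕ} {W B : Set (Space d)} (hB : MeasurableSet B) (hW : B ⊆ W) :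
    MeasurableSet[voidAlgebra W] (void B) := by
  -- The generators are voids of bounded sets, so an unbounded `B` is exhausted by balls.
  have h : void B = ⋂ n : ℕ, void (B ∩ Metric.closedBall 0 n) := by
    ext ξ
    simp only [void, Set.mem_iInter, Set.mem_ofPred_eq, count_eq_zero]
    refine ⟨fun h n x hx hxB => h x hx hxB.1, fun h x hx hxB => ?_⟩
    obtain ⟨n, hn⟩ := exists_nat_ge ‖x‖
    exact h n x hx ⟨hxB, by simpa using hn⟩
  rw [h]
  refine MeasurableSet.iInter fun n => MeasurableSpace.measurableSet_generateFrom
    ⟨_, hB.inter Metric.isClosed_closedBall.measurableSet,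
      Metric.isBounded_closedBall.subset Set.inter_subset_right,
      Set.inter_subset_left.trans hW, rfl⟩

/-- The existence of a finite tuple of points that satisfies an open relation is measurable. -/
theorem measurableSet_exists_tuple {d : ℕ} {ι : Type*} [Finite ι] {W B : Set (Space d)}
    (hB : MeasurableSet B) (hW : B ⊆ W) {R : Set (ι → Space d)} (hR : IsOpen R) :
    MeasurableSet[voidAlgebra W]
      {ξ : Config d | ∃ x : ι → Space d, (∀ i, x i ∈ ξ.carrier ∧ x i ∈ B) ∧ x ∈ R} := by
  have hbas := TopologicalSpace.isBasis_countableBasis (Space d)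
  -- `R` is a countable union of products of basic open sets, and a point of the configuration in
  -- each factor is a finite intersection of complements of voids.
  have h : {ξ : Config d | ∃ x : ι → Space d, (∀ i, x i ∈ ξ.carrier ∧ x i ∈ B) ∧ x ∈ R} =
      ⋃ U : {U : ι → TopologicalSpace.countableBasis (Space d) //
        Set.univ.pi (fun i => (U i : Set (Space d))) ⊆ R}, ⋂ i, (void (B ∩ U.1 i))ᶜ := by
    ext ξ
    simp only [void, Set.mem_ofPred_eq, Set.mem_iUnion, Set.mem_iInter, Set.mem_compl_iff]
    constructor
    · rintro ⟨x, hx, hxR⟩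
      obtain ⟨I, u, hu, hsub⟩ := isOpen_pi_iff.1 hR x hxR
      have : ∀ i, ∃ U ∈ TopologicalSpace.countableBasis (Space d), x i ∈ U ∧ (i ∈ I → U ⊆ u i) := by
        intro i
        by_cases hi : i ∈ I
        · obtain ⟨U, hU, hxU, hUu⟩ := hbas.exists_subset_of_mem_open (hu i hi).2 (hu i hi).1
          exact ⟨U, hU, hxU, fun _ => hUu⟩
        · obtain ⟨U, hU, hxU, -⟩ := hbas.exists_subset_of_mem_open (Set.mem_univ (x i)) isOpen_univ
          exact ⟨U, hU, hxU, fun h => absurd h hi⟩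
      choose U hU hxU hUu using this
      refine ⟨⟨fun i => ⟨U i, hU i⟩, fun y hy => hsub fun i hi => hUu i hi (hy i trivial)⟩,
        fun i => ?_⟩
      exact count_ne_zero.2 ⟨x i, (hx i).1, (hx i).2, hxU i⟩
    · rintro ⟨⟨U, hUR⟩, h⟩
      choose x hx hxB using fun i => count_ne_zero.1 (h i)
      exact ⟨x, fun i => ⟨hx i, (hxB i).1⟩, hUR fun i _ => (hxB i).2⟩
  have : Countable (TopologicalSpace.countableBasis (Space d)) :=
    (TopologicalSpace.countable_countableBasis _).to_subtype
  rw [h]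
  refine MeasurableSet.iUnion fun U => MeasurableSet.iInter fun i => (measurableSet_void
    (hB.inter ?_) (Set.inter_subset_left.trans hW)).compl
  exact (hbas.isOpen (U.1 i).2).measurableSet

/-- A set has at least `n` points exactly when it carries an injective `n`-tuple, and injectivity is
an open relation. -/
theorem measurableSet_le_count {d : ℕ} {W B : Set (Space d)} (hB : MeasurableSet B) (hW : B ⊆ W)
    (n : ℕ) : MeasurableSet[voidAlgebra W] {ξ : Config d | (n : ℕ∞) ≤ ξ.count B} := by
  have hR : IsOpen {x : Fin n → Space d | Function.Injective x} := by
    have : {x : Fin n → Space d | Function.Injective x} =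
        ⋂ i, ⋂ j, ⋂ _ : i ≠ j, {x : Fin n → Space d | x i ≠ x j} := by
      ext x
      simp only [Set.mem_ofPred_eq, Set.mem_iInter]
      exact ⟨fun h i j hij => h.ne hij, fun h i j hij => by_contra fun hne => h i j hne hij⟩
    rw [this]
    refine isOpen_iInter_of_finite fun i => isOpen_iInter_of_finite fun j =>
      isOpen_iInter_of_finite fun _ => isOpen_ne_fun (continuous_apply i) (continuous_apply j)
  convert measurableSet_exists_tuple hB hW hR using 1
  ext ξ
  simp only [Set.mem_ofPred_eq]
  constructor
  · intro h
    obtain ⟨t, ht, htn⟩ := Set.exists_subset_encard_eq h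
    have hfin : t.Finite := Set.finite_of_encard_eq_coe htn
    have hc : hfin.toFinset.card = n := by
      rw [hfin.encard_eq_coe_toFinset_card] at htn; exact_mod_cast htn
    let e := hfin.toFinset.equivFinOfCardEq hc
    refine ⟨fun i => (e.symm i : Space d), fun i => ?_, fun i j hij =>
      e.symm.injective (Subtype.ext hij)⟩
    exact ht (hfin.mem_toFinset.1 (e.symm i).2)
  · rintro ⟨x, hx, hinj⟩
    have h1 : (Set.range x).encard = n := by
      rw [← Set.image_univ, hinj.encard_image]; simp
    rw [← h1]
    exact Set.encard_le_encard (by rintro _ ⟨i, rfl⟩; exact hx i)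

theorem measurableSet_count_preimage {d : ℕ} {W B : Set (Space d)} (hB : MeasurableSet B)
    (hW : B ⊆ W) (s : Set ℕ∞) : MeasurableSet[voidAlgebra W] {ξ : Config d | ξ.count B ∈ s} := by
  have h1 : ∀ m : ℕ∞, MeasurableSet[voidAlgebra W] {ξ : Config d | ξ.count B = m} := by
    intro m
    induction m using ENat.recTopCoe with
    | top =>
      have : {ξ : Config d | ξ.count B = ⊤} = ⋂ n : ℕ, {ξ | (n : ℕ∞) ≤ ξ.count B} := by
        ext ξ; simp [ENat.eq_top_iff_forall_ge]
      rw [this]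
      exact MeasurableSet.iInter fun n => measurableSet_le_count hB hW n
    | coe n =>
      have : {ξ : Config d | ξ.count B = n} =
          {ξ | (n : ℕ∞) ≤ ξ.count B} \ {ξ | ((n + 1 : ℕ) : ℕ∞) ≤ ξ.count B} := by
        ext ξ
        simp only [Set.mem_ofPred_eq, Set.mem_sdiff, not_le]
        rw [Nat.cast_add, Nat.cast_one, ENat.lt_natCast_add_one_iff]
        exact ⟨fun h => ⟨h.ge, h.le⟩, fun h => le_antisymm h.2 h.1⟩
      rw [this]
      exact (measurableSet_le_count hB hW n).diff (measurableSet_le_count hB hW (n + 1))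
  have : {ξ : Config d | ξ.count B ∈ s} = ⋃ m ∈ s, {ξ | ξ.count B = m} := by
    ext ξ; simp
  rw [this]
  exact MeasurableSet.biUnion s.to_countable fun m _ => h1 m

/-- Counts can be recovered from void events, which form a π-system; hence void probabilities alone
identify a law. -/
theorem measurableSpace_eq_voidAlgebra (d : ℕ) :
    (inferInstance : MeasurableSpace (Config d)) = voidAlgebra Set.univ := by
  apply le_antisymm
  · refine iSup₂_le fun B hB => ?_
    rintro _ ⟨s, -, rfl⟩
    exact measurableSet_count_preimage hB (Set.subset_univ B) s
  · refine MeasurableSpace.generateFrom_le ?_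
    rintro _ ⟨B, hB, -, -, rfl⟩
    exact le_iSup₂ (f := fun (B : Set (Space d)) (_ : MeasurableSet B) =>
      MeasurableSpace.comap (fun ξ : Config d => ξ.count B) ⊤) B hB _ ⟨{0}, trivial, rfl⟩

theorem voidAlgebra_mono {d : ℕ} {V W : Set (Space d)} (h : V ⊆ W) :
    voidAlgebra V ≤ voidAlgebra W := by
  refine MeasurableSpace.generateFrom_mono ?_
  rintro _ ⟨B, hB, hb, hV, rfl⟩
  exact ⟨B, hB, hb, hV.trans h, rfl⟩

theorem voidAlgebra_le {d : ℕ} (W : Set (Space d)) :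
    voidAlgebra W ≤ (inferInstance : MeasurableSpace (Config d)) := by
  rw [measurableSpace_eq_voidAlgebra]
  exact voidAlgebra_mono (Set.subset_univ W)

/-- The void probabilities of the Poisson process of intensity `μ`. -/
def HasPoissonVoids {d : ℕ} (Q : Measure (Config d)) (μ : ℝ) : Prop :=
  ∀ B, MeasurableSet B → Bornology.IsBounded B →
    Q (void B) = ENNReal.ofReal (Real.exp (-(μ * (volume B).toReal)))

theorem IsPoissonProcess.hasPoissonVoids {Ω : Type*} [MeasurableSpace Ω] {P : Measure Ω} {d : ℕ}
    {μ : ℝ} {X : Ω → Config d} (h : IsPoissonProcess P μ X) :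
    HasPoissonVoids (P.map X) μ := by
  intro B hB hb
  rw [Measure.map_apply h.measurable
    (voidAlgebra_le _ _ (measurableSet_void hB (Set.subset_univ B)))]
  have := h.law 1 (fun _ => B) (fun _ => 0) (fun _ => hB) (fun _ => hb)
    (fun i j hij => absurd (Subsingleton.elim i j) hij)
  simpa [poissonWeight, void] using this

/-- The void probabilities determine the law. -/
theorem HasPoissonVoids.unique {d : ℕ} {Q Q' : Measure (Config d)} [IsProbabilityMeasure Q]
    [IsProbabilityMeasure Q'] {μ : ℝ} (h : HasPoissonVoids Q μ) (h' : HasPoissonVoids Q' μ) :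
    Q = Q' := by
  refine ext_of_generate_finite (voids Set.univ) (measurableSpace_eq_voidAlgebra d)
    (isPiSystem_voids _) ?_ (by simp)
  rintro _ ⟨B, hB, hb, -, rfl⟩
  rw [h B hB hb, h' B hB hb]

/-- The restrictions of a Poisson process to disjoint sets are independent. -/
theorem HasPoissonVoids.iIndep {d : ℕ} {Q : Measure (Config d)} {μ : ℝ}
    (h : HasPoissonVoids Q μ) {ι : Type*} {W : ι → Set (Space d)}
    (hW : Pairwise (Function.onFun Disjoint W)) : iIndep (fun i => voidAlgebra (W i)) Q := by
  refine iIndepSets.iIndep (fun i => voidAlgebra_le _) (fun i => voids (W i))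
    (fun i => isPiSystem_voids _) (fun i => rfl) ?_
  rw [iIndepSets_iff]
  intro s f hf
  choose! B hB hb hBW hfB using hf
  -- A joint void event is the void event of a disjoint union, and additivity of volume turns the
  -- exponential into a product.
  rw [Set.iInter₂_congr hfB, void_iInter, h _ (Finset.measurableSet_biUnion s hB)
    ((Bornology.isBounded_biUnion_finset s).2 hb), measure_biUnion_finset _ hB,
    ENNReal.toReal_sum fun i hi => (hb i hi).measure_lt_top.ne, Finset.mul_sum,
    ← Finset.sum_neg_distrib, Real.exp_sum,
    ENNReal.ofReal_prod_of_nonneg fun i _ => (Real.exp_pos _).le]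
  · exact Finset.prod_congr rfl fun i hi => by rw [hfB i hi, h _ (hB i hi) (hb i hi)]
  · intro i hi j hj hij
    exact (hW hij).mono (hBW i hi) (hBW j hj)

/-! ### Similarities -/

/-- The similarity `y ↦ b • y + t`. -/
noncomputable def similarity {d : ℕ} (b : ℝ) (hb : 0 < b) (t : Space d) : Space d ≃ₜ Space d :=
  (Homeomorph.smulOfNeZero b hb.ne').trans (Homeomorph.addRight t)

section similarity

variable {d : ℕ} {b : ℝ} (hb : 0 < b) (t : Space d)

theorem similarity_apply (y : Space d) : similarity b hb t y = b • y + t := rfl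

theorem dist_similarity (x y : Space d) :
    dist (similarity b hb t x) (similarity b hb t y) = b * dist x y := by
  rw [similarity_apply, similarity_apply, dist_add_right, dist_smul₀, Real.norm_of_nonneg hb.le]

theorem dist_similarity_symm (x y : Space d) :
    dist ((similarity b hb t).symm x) ((similarity b hb t).symm y) = b⁻¹ * dist x y := by
  rw [eq_inv_mul_iff_mul_eq₀ hb.ne', ← dist_similarity hb t]; simp

theorem isBounded_similarity_preimage {B : Set (Space d)} (hB : Bornology.IsBounded B) :
    Bornology.IsBounded (similarity b hb t ⁻¹' B) := by
  rw [← Homeomorph.image_symm]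
  refine (LipschitzWith.of_dist_le_mul (K := ⟨b⁻¹, (inv_pos.2 hb).le⟩) fun x y => ?_
    : LipschitzWith _ (similarity b hb t).symm).isBounded_image hB
  exact (dist_similarity_symm hb t x y).le

theorem isBounded_similarity_symm_preimage {B : Set (Space d)} (hB : Bornology.IsBounded B) :
    Bornology.IsBounded ((similarity b hb t).symm ⁻¹' B) := by
  rw [← Homeomorph.image_eq_preimage_symm]
  refine (LipschitzWith.of_dist_le_mul (K := ⟨b, hb.le⟩) fun x y => ?_
    : LipschitzWith _ (similarity b hb t)).isBounded_image hB
  exact (dist_similarity hb t x y).le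

theorem volume_similarity_preimage (B : Set (Space d)) :
    volume (similarity b hb t ⁻¹' B) = ENNReal.ofReal ((b ^ d)⁻¹) * volume B := by
  have h : similarity b hb t ⁻¹' B = (fun y : Space d => b • y) ⁻¹' ((fun y => y + t) ⁻¹' B) := rfl
  rw [h, Measure.addHaar_preimage_smul _ hb.ne', measure_preimage_add_right,
    finrank_euclideanSpace_fin, abs_of_pos (by positivity)]

/-- The image of a configuration under a similarity. -/
noncomputable def Config.map (ξ : Config d) : Config d where
  carrier := similarity b hb t '' ξ.carrier
  locallyFinite B hB := by
    rw [← Set.image_inter_preimage]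
    exact (ξ.locallyFinite _ (isBounded_similarity_preimage hb t hB)).image _

/-- The image of a configuration under the inverse of a similarity. -/
noncomputable def Config.comap (ξ : Config d) : Config d where
  carrier := (similarity b hb t).symm '' ξ.carrier
  locallyFinite B hB := by
    rw [← Set.image_inter_preimage]
    exact (ξ.locallyFinite _ (isBounded_similarity_symm_preimage hb t hB)).image _

theorem Config.ext_carrier {ξ η : Config d} (h : ξ.carrier = η.carrier) : ξ = η := by
  cases ξ; cases η; simpa using h

theorem count_map (ξ : Config d) (B : Set (Space d)) :
    (ξ.map hb t).count B = ξ.count (similarity b hb t ⁻¹' B) := by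
  rw [Config.count, Config.count, Config.map, ← Set.image_inter_preimage,
    (similarity b hb t).injective.encard_image]

theorem count_comap (ξ : Config d) (B : Set (Space d)) :
    (ξ.comap hb t).count B = ξ.count ((similarity b hb t).symm ⁻¹' B) := by
  rw [Config.count, Config.count, Config.comap, ← Set.image_inter_preimage,
    (similarity b hb t).symm.injective.encard_image]

theorem measurable_of_preimage_void {Ω : Type*} [MeasurableSpace Ω] {f : Ω → Config d}
    (h : ∀ B, MeasurableSet B → MeasurableSet (f ⁻¹' void B)) : Measurable f := by
  have h1 : @Measurable Ω (Config d) _ (voidAlgebra Set.univ) f := by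
    refine measurable_generateFrom ?_
    rintro _ ⟨B, hB, -, -, rfl⟩
    exact h B hB
  rwa [← measurableSpace_eq_voidAlgebra] at h1

theorem measurableSet_void' {B : Set (Space d)} (hB : MeasurableSet B) :
    MeasurableSet (void B : Set (Config d)) :=
  voidAlgebra_le _ _ (measurableSet_void hB (Set.subset_univ B))

/-- The action of a similarity on configurations. -/
noncomputable def Config.mapEquiv : Config d ≃ᵐ Config d where
  toFun := Config.map hb t
  invFun := Config.comap hb t
  left_inv ξ := Config.ext_carrier <| by
    simp [Config.map, Config.comap, Set.image_image]
  right_inv ξ := Config.ext_carrier <| by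
    simp [Config.map, Config.comap, Set.image_image]
  measurable_toFun := measurable_of_preimage_void fun B hB => by
    have : Config.map hb t ⁻¹' void B = void (similarity b hb t ⁻¹' B) := by
      ext ξ; simp [void, count_map]
    exact this ▸ measurableSet_void' ((similarity b hb t).measurable hB)
  measurable_invFun := measurable_of_preimage_void fun B hB => by
    have : Config.comap hb t ⁻¹' void B = void ((similarity b hb t).symm ⁻¹' B) := by
      ext ξ; simp [void, count_comap]
    exact this ▸ measurableSet_void' ((similarity b hb t).symm.measurable hB)

theorem coe_mapEquiv : ⇑(Config.mapEquiv hb t) = Config.map hb t := rfl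

theorem HasPoissonVoids.map {Q : Measure (Config d)} {μ : ℝ} (h : HasPoissonVoids Q μ) :
    HasPoissonVoids (Q.map (Config.map hb t)) (μ / b ^ d) := by
  intro B hB hb'
  rw [← coe_mapEquiv, MeasurableEquiv.map_apply]
  have : Config.mapEquiv hb t ⁻¹' void B = void (similarity b hb t ⁻¹' B) := by
    ext ξ; simp [void, count_map, coe_mapEquiv]
  rw [this, h _ ((similarity b hb t).measurable hB) (isBounded_similarity_preimage hb t hb'),
    volume_similarity_preimage, ENNReal.toReal_mul, ENNReal.toReal_ofReal (by positivity),
    div_eq_mul_inv, mul_assoc]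

/-! ### Similarities and the tessellation -/

theorem cell_map (ξ : Config d) (x : Space d) :
    cell (ξ.map hb t) (similarity b hb t x) = similarity b hb t '' cell ξ x := by
  ext y
  obtain ⟨y, rfl⟩ := (similarity b hb t).surjective y
  rw [(similarity b hb t).injective.mem_set_image]
  simp only [cell, Config.map, Set.forall_mem_image, Set.mem_ofPred_eq, dist_similarity]
  exact forall₂_congr fun x' _ => mul_le_mul_iff_right₀ hb

theorem faces_map (ξ : Config d) :
    faces (ξ.map hb t) = Set.image (similarity b hb t) '' faces ξ := by
  have key : ∀ N : Set (Space d), N.Nonempty →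
      ⋂ x ∈ similarity b hb t '' N, cell (ξ.map hb t) x =
        similarity b hb t '' ⋂ x ∈ N, cell ξ x := by
    intro N hN
    rw [Set.biInter_image, Set.image_iInter₂ (similarity b hb t).bijective]
    exact Set.iInter₂_congr fun x _ => cell_map hb t ξ x
  ext f
  constructor
  · rintro ⟨hne, N, hN, hNne, rfl⟩
    obtain ⟨N', hN', rfl⟩ := Set.subset_image_iff.1 hN
    have hne' := Set.image_nonempty.1 hNne
    rw [key N' hne'] at hne ⊢
    exact ⟨_, ⟨Set.image_nonempty.1 hne, N', hN', hne', rfl⟩, rfl⟩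
  · rintro ⟨_, ⟨hne, N, hN, hNne, rfl⟩, rfl⟩
    exact ⟨hne.image _, similarity b hb t '' N, Set.image_mono hN, hNne.image _, (key N hNne).symm⟩

theorem finrank_vectorSpan_similarity_image (e : Set (Space d)) :
    Module.finrank ℝ (vectorSpan ℝ (similarity b hb t '' e)) =
      Module.finrank ℝ (vectorSpan ℝ e) := by
  let g : Space d ≃ᵃ[ℝ] Space d := (LinearEquiv.smulOfUnit (Units.mk0 b hb.ne')).toAffineEquiv.trans
    (AffineEquiv.constVAdd ℝ (Space d) t)
  have hg : similarity b hb t '' e = g.toAffineMap '' e := by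
    refine Set.image_congr fun y _ => ?_
    rw [similarity_apply, add_comm]; rfl
  rw [hg, ← AffineMap.map_vectorSpan]
  exact LinearEquiv.finrank_map_eq g.linear _

theorem streets_map (ξ : Config d) :
    streets (ξ.map hb t) = Set.image (similarity b hb t) '' streets ξ := by
  ext f
  simp only [streets, faces_map, Set.mem_ofPred_eq]
  constructor
  · rintro ⟨⟨e, he, rfl⟩, hr⟩
    exact ⟨e, ⟨he, by rwa [finrank_vectorSpan_similarity_image] at hr⟩, rfl⟩
  · rintro ⟨e, ⟨he, hr⟩, rfl⟩
    exact ⟨⟨e, he, rfl⟩, by rwa [finrank_vectorSpan_similarity_image]⟩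

theorem crossroads_map (ξ : Config d) :
    crossroads (ξ.map hb t) = similarity b hb t '' crossroads ξ := by
  ext v
  obtain ⟨v, rfl⟩ := (similarity b hb t).surjective v
  rw [(similarity b hb t).injective.mem_set_image]
  simp only [crossroads, faces_map, Set.mem_ofPred_eq]
  rw [← Set.image_singleton, (Set.image_injective.2 (similarity b hb t).injective).mem_set_image]

open scoped Pointwise in
theorem hausdorffMeasure_similarity_image (s : Set (Space d)) :
    Measure.hausdorffMeasure 1 (similarity b hb t '' s) =
      ENNReal.ofReal b * Measure.hausdorffMeasure 1 s := by
  have h : similarity b hb t '' s = (IsometryEquiv.addRight t) '' (b • s) := by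
    rw [← Set.image_smul, Set.image_image]; rfl
  rw [h, (IsometryEquiv.addRight t).isometry.hausdorffMeasure_image (Or.inl zero_le_one),
    Measure.hausdorffMeasure_smul₀ zero_le_one hb.ne', NNReal.rpow_one, ENNReal.smul_def,
    smul_eq_mul]
  congr 1
  rw [← ENNReal.ofReal_coe_nnreal, coe_nnnorm, Real.norm_of_nonneg hb.le]

theorem streetMeasure_map (ξ : Config d) {B : Set (Space d)} (hB : MeasurableSet B) :
    streetMeasure (ξ.map hb t) B =
      ENNReal.ofReal b * streetMeasure ξ (similarity b hb t ⁻¹' B) := by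
  rw [streetMeasure, streetMeasure, Measure.restrict_apply hB,
    Measure.restrict_apply ((similarity b hb t).measurable hB), streets_map, Set.sUnion_image,
    ← Set.image_iUnion₂, ← Set.sUnion_eq_biUnion, ← hausdorffMeasure_similarity_image hb t,
    ← Set.image_preimage_inter]

theorem segment_similarity (x y : Space d) :
    segment ℝ (similarity b hb t x) (similarity b hb t y) =
      similarity b hb t '' segment ℝ x y := by
  let g : Space d →ᵃ[ℝ] Space d := b • AffineMap.id ℝ (Space d) + AffineMap.const ℝ (Space d) t
  exact (image_segment ℝ g x y).symm

theorem midpoint_similarity (x y : Space d) :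
    midpoint ℝ (similarity b hb t x) (similarity b hb t y) =
      similarity b hb t (midpoint ℝ x y) := by
  let g : Space d →ᵃ[ℝ] Space d := b • AffineMap.id ℝ (Space d) + AffineMap.const ℝ (Space d) t
  exact (g.map_midpoint x y).symm

theorem streetsCenteredIn_map (ξ : Config d) (W : Set (Space d)) :
    streetsCenteredIn (ξ.map hb t) W =
      Set.image (similarity b hb t) '' streetsCenteredIn ξ (similarity b hb t ⁻¹' W) := by
  ext f
  simp only [streetsCenteredIn, streets_map, Set.mem_ofPred_eq]
  constructor
  · rintro ⟨⟨e, he, rfl⟩, x, y, hxy, hm⟩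
    obtain ⟨x, rfl⟩ := (similarity b hb t).surjective x
    obtain ⟨y, rfl⟩ := (similarity b hb t).surjective y
    rw [segment_similarity] at hxy
    rw [midpoint_similarity] at hm
    exact ⟨e, ⟨he, x, y, Set.image_injective.2 (similarity b hb t).injective hxy, hm⟩, rfl⟩
  · rintro ⟨e, ⟨he, x, y, rfl, hm⟩, rfl⟩
    exact ⟨⟨_, he, rfl⟩, _, _, (segment_similarity hb t x y).symm,
      by rwa [midpoint_similarity]⟩

theorem meanStreetLengthIn_map (Q : Measure (Config d)) (W : Set (Space d)) :
    meanStreetLengthIn (Q.map (Config.map hb t)) W =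
      ENNReal.ofReal b * meanStreetLengthIn Q (similarity b hb t ⁻¹' W) := by
  have hinj : Function.Injective (Set.image (similarity b hb t)) :=
    Set.image_injective.2 (similarity b hb t).injective
  rw [meanStreetLengthIn, meanStreetLengthIn, ← coe_mapEquiv, lintegral_map_equiv,
    lintegral_map_equiv, ← mul_div_assoc, ← lintegral_const_mul' _ _ ENNReal.ofReal_ne_top]
  congr 1
  · refine lintegral_congr fun ξ => ?_
    rw [coe_mapEquiv, streetsCenteredIn_map, ← ENNReal.tsum_mul_left,
      ← (Equiv.Set.image _ (streetsCenteredIn ξ (similarity b hb t ⁻¹' W)) hinj).tsum_eq]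
    exact tsum_congr fun e => hausdorffMeasure_similarity_image hb t e
  · refine lintegral_congr fun ξ => ?_
    rw [coe_mapEquiv, streetsCenteredIn_map, hinj.encard_image]

/-- The side of the reference window is a power of the intensity that scales like a length, so the
similarity carries window to window and no independence of the window is needed. -/
theorem meanStreetLength_map (hd : d ≠ 0) (Q : Measure (Config d)) {μ : ℝ} (hμ : 0 < μ) :
    meanStreetLength (μ / b ^ d) (Q.map (Config.map hb (0 : Space d))) =
      b * meanStreetLength μ Q := by
  rw [meanStreetLength, meanStreetLengthIn_map, ENNReal.toReal_mul, ENNReal.toReal_ofReal hb.le,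
    meanStreetLength]
  congr 3
  have h : (μ / b ^ d) ^ (-(1 : ℝ) / d) = b * μ ^ (-(1 : ℝ) / d) := by
    rw [Real.div_rpow hμ.le (by positivity), ← Real.rpow_natCast, ← Real.rpow_mul hb.le,
      mul_div_cancel₀ _ (Nat.cast_ne_zero.2 hd), Real.rpow_neg_one, div_inv_eq_mul, mul_comm]
  ext y
  simp only [Set.mem_preimage, similarity_apply, Set.mem_ofPred_eq, h, add_zero, PiLp.smul_apply,
    smul_eq_mul, Set.mem_Icc]
  exact forall_congr' fun i => and_congr (mul_nonneg_iff_of_pos_left hb)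
    (mul_le_mul_iff_right₀ hb)

end similarity

/-! ### Unit cubes -/

/-- The index of the unit cube that contains a point. -/
noncomputable def cubeIndex {d : ℕ} (y : Space d) : Fin d → ℤ := fun i => ⌊y i⌋

/-- Cube indices at sup-distance at most `K`. -/
def Near {d : ℕ} (K : ℤ) (z w : Fin d → ℤ) : Prop := ∀ i, |w i - z i| ≤ K

/-- The union of the unit cubes whose index is at sup-distance at most `K` from `z`. -/
def block {d : ℕ} (K : ℤ) (z : Fin d → ℤ) : Set (Space d) := {y | Near K z (cubeIndex y)}

theorem Near.symm {d : ℕ} {K : ℤ} {z w : Fin d → ℤ} (h : Near K z w) : Near K w z :=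
  fun i => by rw [abs_sub_comm]; exact h i

theorem Near.trans {d : ℕ} {K L : ℤ} {z w v : Fin d → ℤ} (h : Near K z w) (h' : Near L w v) :
    Near (K + L) z v := fun i => by
  have := h i; have := h' i; rw [abs_le] at *; constructor <;> linarith

theorem Near.mono {d : ℕ} {K L : ℤ} {z w : Fin d → ℤ} (h : Near K z w) (hKL : K ≤ L) :
    Near L z w := fun i => (h i).trans hKL

theorem measurableSet_block {d : ℕ} (K : ℤ) (z : Fin d → ℤ) :
    MeasurableSet (block K z : Set (Space d)) := by
  have : (block K z : Set (Space d)) = ⋂ i, {y | |⌊y i⌋ - z i| ≤ K} := by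
    ext y; simp [block, Near, cubeIndex]
  rw [this]
  refine MeasurableSet.iInter fun i => ?_
  have h1 : Measurable fun y : Space d => ⌊y i⌋ :=
    Int.measurable_floor.comp (by fun_prop)
  exact h1 (t := {n : ℤ | |n - z i| ≤ K}) (MeasurableSet.of_discrete)

theorem abs_coord_sub_le_dist {d : ℕ} (y w : Space d) (i : Fin d) : |y i - w i| ≤ dist y w := by
  rw [dist_eq_norm]
  exact PiLp.norm_apply_le (y - w) i

theorem dist_le_of_coord {d : ℕ} {y w : Space d} {c : ℝ} (hc : 0 ≤ c)
    (h : ∀ i, |y i - w i| ≤ c) : dist y w ≤ d * c := by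
  rw [EuclideanSpace.dist_eq]
  refine Real.sqrt_le_iff.2 ⟨by positivity, ?_⟩
  calc ∑ i, dist (y i) (w i) ^ 2 ≤ ∑ _i : Fin d, c ^ 2 :=
        Finset.sum_le_sum fun i _ => pow_le_pow_left₀ dist_nonneg (h i) 2
    _ = d * c ^ 2 := by simp
    _ ≤ (d * c) ^ 2 := by
        rw [mul_pow]
        refine mul_le_mul_of_nonneg_right ?_ (sq_nonneg c)
        exact_mod_cast Nat.le_self_pow two_ne_zero d

theorem dist_le_of_mem_block {d : ℕ} {K : ℤ} (hK : 0 ≤ K) {z : Fin d → ℤ} {y w : Space d}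
    (hy : y ∈ block K z) (hw : w ∈ block K z) : dist y w ≤ d * (2 * K + 1) := by
  have hK' : (0 : ℝ) ≤ K := by exact_mod_cast hK
  refine dist_le_of_coord (by positivity) fun i => ?_
  have h1 : |(⌊y i⌋ : ℝ) - z i| ≤ K := by exact_mod_cast hy i
  have h2 : |(⌊w i⌋ : ℝ) - z i| ≤ K := by exact_mod_cast hw i
  have := Int.floor_le (y i); have := Int.lt_floor_add_one (y i)
  have := Int.floor_le (w i); have := Int.lt_floor_add_one (w i)
  rw [abs_le] at *; constructor <;> linarith

theorem isBounded_block {d : ℕ} (K : ℤ) (z : Fin d → ℤ) :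
    Bornology.IsBounded (block K z : Set (Space d)) := by
  by_cases hK : 0 ≤ K
  · exact Metric.isBounded_iff.2 ⟨_, fun y hy w hw => dist_le_of_mem_block hK hy hw⟩
  -- For negative `K` the block is empty, unless `d = 0`, where the space is a single point.
  · refine (Metric.isBounded_iff).2 ⟨d, fun y hy w hw => ?_⟩
    rcases isEmpty_or_nonempty (Fin d) with h | ⟨⟨i⟩⟩
    · simp [Subsingleton.elim y w]
    · exact absurd ((abs_nonneg _).trans (hy i)) hK

theorem near_cubeIndex_of_dist_le {d n : ℕ} {y w : Space d} (h : dist y w ≤ n) :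
    Near n (cubeIndex y) (cubeIndex w) := fun i => by
  have h0 := (abs_coord_sub_le_dist y w i).trans h
  have := Int.floor_le (y i); have := Int.lt_floor_add_one (y i)
  have := Int.floor_le (w i); have := Int.lt_floor_add_one (w i)
  rw [abs_le] at h0
  rw [abs_le]
  simp only [cubeIndex]
  constructor
  · have : ((⌊y i⌋ : ℝ)) < ⌊w i⌋ + n + 1 := by linarith
    have : ⌊y i⌋ < ⌊w i⌋ + n + 1 := by exact_mod_cast this
    linarith
  · have : ((⌊w i⌋ : ℝ)) < ⌊y i⌋ + n + 1 := by linarith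
    have : ⌊w i⌋ < ⌊y i⌋ + n + 1 := by exact_mod_cast this
    linarith

theorem dist_le_of_cubeIndex_eq {d : ℕ} {y w : Space d} (h : cubeIndex y = cubeIndex w) :
    dist y w ≤ d := by
  have := dist_le_of_mem_block (K := 0) le_rfl (z := cubeIndex w) (y := y) (w := w)
    (fun i => by rw [h]; simp) (fun i => by simp)
  simpa using this

theorem disjoint_block {d : ℕ} {K : ℤ} {z w : Fin d → ℤ} (h : ¬ Near (2 * K) z w) :
    Disjoint (block K z : Set (Space d)) (block K w) :=
  Set.disjoint_left.2 fun y hy hw => h (by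
    rw [two_mul]; exact Near.trans (show Near K z (cubeIndex y) from hy) (Near.symm hw))

/-! ### Nuclei of a crossroad -/

/-- The nuclei whose cell contains `v`. -/
def nearestNuclei {d : ℕ} (ξ : Config d) (v : Space d) : Set (Space d) :=
  {x | x ∈ ξ.carrier ∧ v ∈ cell ξ x}

/-- Every unit cube around the cube `z` contains a nucleus. -/
def Occupied {d : ℕ} (z : Fin d → ℤ) (ξ : Config d) : Prop :=
  ∀ w, Near 1 z w → ξ.count (block 0 w) ≠ 0

/-- The cube of `v` contains a nucleus, at distance at most `d` from `v`; a nearest nucleus is no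
farther. This makes the tessellation in `block 1 z` a function of nearby nuclei. -/
theorem mem_block_of_mem_nearestNuclei {d : ℕ} {ξ : Config d} {z : Fin d → ℤ} (h : Occupied z ξ)
    {v x : Space d} (hv : v ∈ block 1 z) (hx : x ∈ nearestNuclei ξ v) :
    x ∈ block (d + 1) z := by
  obtain ⟨y, hy, hyv⟩ := count_ne_zero.1 (h _ hv)
  have h0 : cubeIndex v = cubeIndex y := by
    ext i
    have := hyv i
    exact (sub_eq_zero.1 (abs_nonpos_iff.1 this)).symm
  have h1 : dist v x ≤ d := (hx.2 y hy).trans (dist_le_of_cubeIndex_eq h0)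
  have := Near.trans (show Near 1 z (cubeIndex v) from hv) (near_cubeIndex_of_dist_le h1)
  rwa [add_comm] at this

/-- Otherwise some `u ≠ 0` is orthogonal to all differences of nearest nuclei. Moving `v` slightly
along `u` keeps these nuclei equidistant and nearest, so the face would contain more than `v`. -/
theorem vectorSpan_nearestNuclei {d : ℕ} {ξ : Config d} {v : Space d} (hv : v ∈ crossroads ξ) :
    (nearestNuclei ξ v).Nonempty ∧ vectorSpan ℝ (nearestNuclei ξ v) = ⊤ := by
  obtain ⟨-, N, hN, ⟨x₀, hx₀⟩, hface⟩ := hv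
  have hsub : N ⊆ nearestNuclei ξ v := fun x hx => ⟨hN hx,
    Set.mem_iInter₂.1 (hface ▸ Set.mem_singleton v) x hx⟩
  refine ⟨⟨x₀, hsub hx₀⟩, ?_⟩
  by_contra hne
  obtain ⟨u, hu, hu0⟩ := Submodule.exists_mem_ne_zero_of_ne_bot
    (mt (Submodule.orthogonal_eq_bot_iff).1 hne)
  have hmin : ∀ x' ∈ ξ.carrier, dist v x₀ ≤ dist v x' := (hsub hx₀).2
  have heq : ∀ x ∈ nearestNuclei ξ v, ∀ ε : ℝ, dist (v + ε • u) x = dist (v + ε • u) x₀ := by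
    intro x hx ε
    have hd : dist v x = dist v x₀ := le_antisymm (hx.2 x₀ (hsub hx₀).1) (hmin x hx.1)
    have hin : inner ℝ (x - x₀) u = 0 :=
      (Submodule.mem_orthogonal _ _).1 hu _ (vsub_mem_vectorSpan ℝ hx (hsub hx₀))
    have h1 : ∀ y : Space d, dist (v + ε • u) y ^ 2 =
        dist v y ^ 2 + 2 * ε * (inner ℝ v u - inner ℝ y u) + ε ^ 2 * ‖u‖ ^ 2 := by
      intro y
      rw [dist_eq_norm, dist_eq_norm, show v + ε • u - y = (v - y) + ε • u by abel,
        norm_add_sq_real, inner_smul_right, norm_smul, inner_sub_left, mul_pow, Real.norm_eq_abs,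
        sq_abs]
      ring
    rw [inner_sub_left] at hin
    have h2 : dist (v + ε • u) x ^ 2 = dist (v + ε • u) x₀ ^ 2 := by
      rw [h1, h1, hd, sub_eq_zero.1 hin]
    exact (sq_eq_sq₀ dist_nonneg dist_nonneg).1 h2
  have hcont : ∀ y : Space d, Filter.Tendsto (fun ε : ℝ => dist (v + ε • u) y) (nhds 0)
      (nhds (dist v y)) := by
    intro y
    have : Continuous fun ε : ℝ => dist (v + ε • u) y := by fun_prop
    simpa using this.tendsto 0
  -- A displacement of less than 1 changes distances by less than 1, so nuclei beyond this radius
  -- cannot become nearest; only finitely many remain to be compared.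
  have hfin := ξ.locallyFinite (Metric.closedBall v (dist v x₀ + 2)) Metric.isBounded_closedBall
  have h1 : ∀ᶠ ε in nhds (0 : ℝ), ∀ x' ∈ ξ.carrier ∩ Metric.closedBall v (dist v x₀ + 2),
      dist (v + ε • u) x₀ ≤ dist (v + ε • u) x' := by
    refine (Filter.eventually_all_finite hfin).2 fun x' hx' => ?_
    by_cases hx : x' ∈ nearestNuclei ξ v
    · exact Filter.Eventually.of_forall fun ε => (heq x' hx ε).ge
    · have hlt : dist v x₀ < dist v x' := by
        by_contra hle
        exact hx ⟨hx'.1, fun y hy => (not_lt.1 hle).trans (hmin y hy)⟩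
      filter_upwards [(hcont x₀).eventually_lt (hcont x') hlt] with ε hε using hε.le
  have h2 : ∀ᶠ ε in nhds (0 : ℝ), dist (v + ε • u) v < 1 := by
    have := (hcont v).eventually_lt tendsto_const_nhds (show dist v v < 1 by simp)
    exact this
  have h3 : ∀ᶠ ε in nhds (0 : ℝ), v + ε • u ∈ ({v} : Set (Space d)) := by
    filter_upwards [h1, h2] with ε hε1 hε2
    rw [hface]
    refine Set.mem_iInter₂.2 fun x hx x' hx' => ?_
    rw [heq x (hsub hx)]
    by_cases hb : x' ∈ Metric.closedBall v (dist v x₀ + 2)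
    · exact hε1 x' ⟨hx', hb⟩
    · rw [Metric.mem_closedBall, not_le, dist_comm x' v] at hb
      have := dist_triangle (v + ε • u) v x₀
      have := dist_triangle_left v x' (v + ε • u)
      linarith
  obtain ⟨δ, hδ, hball⟩ := Metric.eventually_nhds_iff.1 h3
  have := hball (y := δ / 2) (by rw [Real.dist_0_eq_abs, abs_of_pos (half_pos hδ)]; linarith)
  rw [Set.mem_singleton_iff, add_eq_left, smul_eq_zero] at this
  exact this.elim (half_pos hδ).ne' hu0

/-! ### Circumcenters -/

/-- The matrix of the edge vectors of a simplex at its first vertex. -/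
def edgeMatrix {d : ℕ} (x : Fin (d + 1) → Space d) : Matrix (Fin d) (Fin d) ℝ :=
  Matrix.of fun i j => x i.succ j - x 0 j

/-- The coordinates of the circumcenter of a nondegenerate simplex. -/
noncomputable def circumcenter {d : ℕ} (x : Fin (d + 1) → Space d) : Fin d → ℝ :=
  (edgeMatrix x)⁻¹.mulVec fun i => (‖x i.succ‖ ^ 2 - ‖x 0‖ ^ 2) / 2

/-- Subtracting the squared equidistance equations leaves a linear system for `v` with matrix
`edgeMatrix x`. -/
theorem circumcenter_eq {d : ℕ} {x : Fin (d + 1) → Space d} (hx : (edgeMatrix x).det ≠ 0)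
    {v : Space d} (h : ∀ i, dist v (x i) = dist v (x 0)) : circumcenter x = fun i => v i := by
  have h1 : (edgeMatrix x).mulVec (fun i => v i) =
      fun i => (‖x i.succ‖ ^ 2 - ‖x 0‖ ^ 2) / 2 := by
    ext i
    have h2 := congrArg (· ^ 2) (h i.succ)
    simp only [dist_eq_norm, norm_sub_sq_real] at h2
    have h3 : (edgeMatrix x).mulVec (fun i => v i) i =
        inner ℝ v (x i.succ) - inner ℝ v (x 0) := by
      simp [Matrix.mulVec, dotProduct, edgeMatrix, PiLp.inner_apply, sub_mul,
        Finset.sum_sub_distrib]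
    rw [h3]
    linarith
  rw [circumcenter, ← h1, Matrix.mulVec_mulVec, Matrix.nonsing_inv_mul _ (isUnit_iff_ne_zero.2 hx),
    Matrix.one_mulVec]

/-- A basis is extracted from the spanning differences of nearest nuclei. No general position is
required: a crossroad may have more than `d + 1` nearest nuclei. -/
theorem exists_simplex_of_mem_crossroads {d : ℕ} {ξ : Config d} {v : Space d}
    (hv : v ∈ crossroads ξ) : ∃ x : Fin (d + 1) → Space d, (∀ i, x i ∈ nearestNuclei ξ v) ∧
      (edgeMatrix x).det ≠ 0 ∧ circumcenter x = fun i => v i := by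
  obtain ⟨⟨x₀, hx₀⟩, hspan⟩ := vectorSpan_nearestNuclei hv
  rw [vectorSpan_eq_span_vsub_set_right ℝ hx₀] at hspan
  obtain ⟨b, hb, hbs, hli⟩ := exists_linearIndependent ℝ ((· -ᵥ x₀) '' nearestNuclei ξ v)
  rw [hspan] at hbs
  let B := Module.Basis.mk hli (by rw [Subtype.range_coe, hbs])
  have : Fintype b := FiniteDimensional.fintypeBasisIndex B
  have hcard : Fintype.card b = d := by
    rw [← Module.finrank_eq_card_basis B, finrank_euclideanSpace_fin]
  let e := Fintype.equivFinOfCardEq hcard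
  choose g hg hgb using fun i : Fin d => hb (e.symm i).2
  have hx : ∀ i, Fin.cons (α := fun _ => Space d) x₀ g i ∈ nearestNuclei ξ v := by
    intro i
    refine Fin.cases ?_ (fun j => ?_) i
    · simpa using hx₀
    · simpa using hg j
  have hdet : (edgeMatrix (Fin.cons (α := fun _ => Space d) x₀ g)).det ≠ 0 := by
    rw [← isUnit_iff_ne_zero, ← Matrix.isUnit_iff_isUnit_det,
      ← Matrix.linearIndependent_rows_iff_isUnit]
    have h1 : LinearIndependent ℝ fun i : Fin d => g i - x₀ := by
      rw [show (fun i : Fin d => g i - x₀) = Subtype.val ∘ e.symm from funext hgb]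
      exact hli.comp e.symm e.symm.injective
    have h2 := h1.map' (WithLp.linearEquiv 2 ℝ (Fin d → ℝ)).toLinearMap (LinearEquiv.ker _)
    have h3 : (edgeMatrix (Fin.cons (α := fun _ => Space d) x₀ g)).row =
        (WithLp.linearEquiv 2 ℝ (Fin d → ℝ)).toLinearMap ∘ fun i => g i - x₀ := by
      ext i j
      simp [edgeMatrix, Matrix.row]
    rw [h3]
    exact h2
  refine ⟨_, hx, hdet, circumcenter_eq hdet fun i => ?_⟩
  exact le_antisymm ((hx i).2 _ (hx 0).1) ((hx 0).2 _ (hx i).1)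

/-- Pairs of nondegenerate simplices with distinct circumcenters closer than `ρ`. -/
def closeCenters (d : ℕ) (ρ : ℝ) : Set (Fin (d + 1) ⊕ Fin (d + 1) → Space d) :=
  {x | ((edgeMatrix (x ∘ Sum.inl)).det ≠ 0 ∧ (edgeMatrix (x ∘ Sum.inr)).det ≠ 0) ∧
    circumcenter (x ∘ Sum.inl) ≠ circumcenter (x ∘ Sum.inr) ∧
    dist (circumcenter (x ∘ Sum.inl)) (circumcenter (x ∘ Sum.inr)) < ρ}

theorem continuous_edgeMatrix (d : ℕ) :
    Continuous (edgeMatrix : (Fin (d + 1) → Space d) → Matrix (Fin d) (Fin d) ℝ) := by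
  refine continuous_matrix fun i j => ?_
  simp only [edgeMatrix, Matrix.of_apply]
  fun_prop

theorem continuousAt_circumcenter {d : ℕ} {x : Fin (d + 1) → Space d}
    (hx : (edgeMatrix x).det ≠ 0) : ContinuousAt circumcenter x := by
  have h1 : ContinuousAt (fun x : Fin (d + 1) → Space d => (edgeMatrix x)⁻¹) x := by
    refine ContinuousAt.comp (g := Inv.inv) (f := edgeMatrix) ?_
      (continuous_edgeMatrix d).continuousAt
    refine continuousAt_matrix_inv _ ?_
    obtain ⟨u, hu⟩ := isUnit_iff_ne_zero.2 hx
    rw [← hu]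
    exact NormedRing.inverse_continuousAt u
  have h2 : Continuous fun p : Matrix (Fin d) (Fin d) ℝ × (Fin d → ℝ) => p.1.mulVec p.2 :=
    continuous_fst.matrix_mulVec continuous_snd
  have h3 : Continuous fun x : Fin (d + 1) → Space d =>
      fun i : Fin d => (‖x i.succ‖ ^ 2 - ‖x 0‖ ^ 2) / 2 := by fun_prop
  exact h2.continuousAt.comp (h1.prodMk h3.continuousAt)

/-- Circumcenters depend continuously on nondegenerate simplices. Openness is what
`measurableSet_exists_tuple` asks for. -/
theorem isOpen_closeCenters (d : ℕ) (ρ : ℝ) : IsOpen (closeCenters d ρ) := by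
  have hl : Continuous fun x : Fin (d + 1) ⊕ Fin (d + 1) → Space d => x ∘ Sum.inl :=
    continuous_pi fun i => continuous_apply _
  have hr : Continuous fun x : Fin (d + 1) ⊕ Fin (d + 1) → Space d => x ∘ Sum.inr :=
    continuous_pi fun i => continuous_apply _
  have hU : IsOpen {x : Fin (d + 1) ⊕ Fin (d + 1) → Space d |
      (edgeMatrix (x ∘ Sum.inl)).det ≠ 0 ∧ (edgeMatrix (x ∘ Sum.inr)).det ≠ 0} :=
    (isOpen_ne_fun ((continuous_edgeMatrix d).comp hl).matrix_det continuous_const).inter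
      (isOpen_ne_fun ((continuous_edgeMatrix d).comp hr).matrix_det continuous_const)
  have hc : ContinuousOn (fun x : Fin (d + 1) ⊕ Fin (d + 1) → Space d =>
      (circumcenter (x ∘ Sum.inl), circumcenter (x ∘ Sum.inr)))
      {x | (edgeMatrix (x ∘ Sum.inl)).det ≠ 0 ∧ (edgeMatrix (x ∘ Sum.inr)).det ≠ 0} := by
    intro x hx
    refine ContinuousAt.continuousWithinAt (ContinuousAt.prodMk ?_ ?_)
    · exact (continuousAt_circumcenter hx.1).comp (f := fun x => x ∘ Sum.inl) hl.continuousAt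
    · exact (continuousAt_circumcenter hx.2).comp (f := fun x => x ∘ Sum.inr) hr.continuousAt
  have ho : IsOpen {p : (Fin d → ℝ) × (Fin d → ℝ) | p.1 ≠ p.2 ∧ dist p.1 p.2 < ρ} :=
    (isOpen_ne_fun continuous_fst continuous_snd).inter
      (isOpen_lt continuous_dist continuous_const)
  exact hc.isOpen_inter_preimage hU ho

/-! ### The street length in a block -/

/-- Seen from one of its points, `s` lies in an isometric copy of `[-δ, δ]`. -/
theorem hausdorffMeasure_le_of_subset_line {d : ℕ} {e s : Set (Space d)}
    (he : Module.finrank ℝ (vectorSpan ℝ e) = 1) (hs : s ⊆ e) {δ : ℝ}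
    (hδ : ∀ x ∈ s, ∀ y ∈ s, dist x y ≤ δ) :
    Measure.hausdorffMeasure 1 s ≤ ENNReal.ofReal (2 * δ) := by
  rcases s.eq_empty_or_nonempty with rfl | ⟨p, hp⟩
  · simp
  obtain ⟨⟨u, hu⟩, hu0, hspan⟩ := finrank_eq_one_iff'.1 he
  have hu0' : u ≠ 0 := fun h => hu0 (Subtype.ext h)
  set w : Space d := ‖u‖⁻¹ • u with hw
  have hw1 : ‖w‖ = 1 := by
    rw [hw, norm_smul, norm_inv, norm_norm, inv_mul_cancel₀ (norm_ne_zero_iff.2 hu0')]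
  have hiso : Isometry fun c : ℝ => c • w + p := by
    refine Isometry.of_dist_eq fun a b => ?_
    rw [dist_add_right, dist_eq_norm, ← sub_smul, norm_smul, hw1, mul_one, dist_eq_norm]
  have hsub : s ⊆ (fun c : ℝ => c • w + p) '' Set.Icc (-δ) δ := by
    intro y hy
    obtain ⟨c, hc⟩ := hspan ⟨y - p, vsub_mem_vectorSpan ℝ (hs hy) (hs hp)⟩
    have hc' : c • u = y - p := congrArg Subtype.val hc
    have hyw : (c * ‖u‖) • w + p = y := by
      rw [hw, smul_smul, mul_assoc, mul_inv_cancel₀ (norm_ne_zero_iff.2 hu0'), mul_one, hc']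
      abel
    refine ⟨c * ‖u‖, ?_, hyw⟩
    refine abs_le.1 ?_
    have := hδ y hy p hp
    rwa [← hyw, dist_eq_norm, add_sub_cancel_right, norm_smul, hw1, mul_one] at this
  calc Measure.hausdorffMeasure 1 s
      ≤ Measure.hausdorffMeasure 1 ((fun c : ℝ => c • w + p) '' Set.Icc (-δ) δ) :=
        measure_mono hsub
    _ = ENNReal.ofReal (2 * δ) := by
        rw [hiso.hausdorffMeasure_image (Or.inl zero_le_one), hausdorffMeasure_real,
          Real.volume_Icc]
        congr 1; ring

/-- A street that meets the block is the intersection of the cells of some set of nuclei, all in the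
larger block. There are at most `2 ^ M` such sets, and each street meets the block in a set of
diameter at most `3 * d`. -/
theorem streetMeasure_block_le {d : ℕ} {ξ : Config d} {z : Fin d → ℤ} (h : Occupied z ξ) {M : ℕ}
    (hM : ξ.count (block (d + 1) z) ≤ M) :
    (streetMeasure ξ (block 1 z)).toReal ≤ 2 ^ M * (6 * d) := by
  classical
  have hfin := ξ.locallyFinite _ (isBounded_block (d + 1) z)
  have hsub : block 1 z ∩ ⋃₀ streets ξ ⊆
      ⋃ N ∈ hfin.toFinset.powerset.filter (fun N => (⋂ x ∈ N, cell ξ x) ∈ streets ξ),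
        block 1 z ∩ ⋂ x ∈ N, cell ξ x := by
    rintro y ⟨hy, e, he, hye⟩
    obtain ⟨N, hN, hNne, rfl⟩ := he.1.2
    have hNsub : N ⊆ ξ.carrier ∩ block (d + 1) z := fun x hx => ⟨hN hx,
      mem_block_of_mem_nearestNuclei h hy ⟨hN hx, Set.mem_iInter₂.1 hye x hx⟩⟩
    have hNf : N.Finite := hfin.subset hNsub
    refine Set.mem_iUnion₂.2 ⟨hNf.toFinset, ?_, hy, by simpa using hye⟩
    rw [Finset.mem_filter, Finset.mem_powerset]
    exact ⟨Set.Finite.toFinset_mono hNsub, by simpa using he⟩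
  have hcard : hfin.toFinset.card ≤ M := by
    rw [Config.count, hfin.encard_eq_coe_toFinset_card] at hM
    exact_mod_cast hM
  have hle : streetMeasure ξ (block 1 z) ≤ ENNReal.ofReal (2 ^ M * (6 * d)) := by
    rw [streetMeasure, Measure.restrict_apply (measurableSet_block 1 z)]
    calc _ ≤ _ := measure_mono hsub
      _ ≤ _ := measure_biUnion_finset_le _ _
      _ ≤ ∑ N ∈ hfin.toFinset.powerset.filter (fun N => (⋂ x ∈ N, cell ξ x) ∈ streets ξ),
          ENNReal.ofReal (6 * d) := by
        refine Finset.sum_le_sum fun N hN => ?_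
        refine (hausdorffMeasure_le_of_subset_line (Finset.mem_filter.1 hN).2.2
          Set.inter_subset_right (δ := d * 3) fun x hx y hy => ?_).trans_eq (by ring_nf)
        exact (dist_le_of_mem_block zero_le_one hx.1 hy.1).trans_eq (by norm_num)
      _ ≤ ENNReal.ofReal (2 ^ M * (6 * d)) := by
        have hc : (hfin.toFinset.powerset.filter
            (fun N => (⋂ x ∈ N, cell ξ x) ∈ streets ξ)).card ≤ 2 ^ M :=
          (Finset.card_filter_le _ _).trans
            (by rw [Finset.card_powerset]; exact Nat.pow_le_pow_right two_pos hcard)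
        rw [Finset.sum_const, nsmul_eq_mul, ENNReal.ofReal_mul (p := 2 ^ M) (by positivity),
          ENNReal.ofReal_pow zero_le_two, ENNReal.ofReal_ofNat]
        gcongr
        exact_mod_cast hc
  exact ENNReal.toReal_le_of_le_ofReal (by positivity) hle

/-! ### Separated chains of cubes -/

theorem Near.refl {d : ℕ} {K : ℤ} (hK : 0 ≤ K) (z : Fin d → ℤ) : Near K z z := fun i => by simpa

/-- The finite set of cube indices at sup-distance at most `K`. -/
noncomputable def nearFinset {d : ℕ} (K : ℤ) (z : Fin d → ℤ) : Finset (Fin d → ℤ) :=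
  Fintype.piFinset fun i => Finset.Icc (z i - K) (z i + K)

theorem mem_nearFinset {d : ℕ} {K : ℤ} {z w : Fin d → ℤ} : w ∈ nearFinset K z ↔ Near K z w := by
  simp only [nearFinset, Fintype.mem_piFinset, Finset.mem_Icc, Near, abs_le]
  exact forall_congr' fun i => by constructor <;> rintro ⟨h1, h2⟩ <;> constructor <;> linarith

theorem card_nearFinset {d : ℕ} (K : ℤ) (z : Fin d → ℤ) :
    (nearFinset K z).card = (2 * K + 1).toNat ^ d := by
  simp only [nearFinset, Fintype.card_piFinset, Int.card_Icc]
  rw [Finset.prod_congr rfl fun i _ => by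
    rw [show z i + K + 1 - (z i - K) = 2 * K + 1 by ring]]
  simp

/-- The vertex sets of the chains of `n + 1` cubes that start in `z` and have steps of size at most
`D`. -/
noncomputable def chains {d : ℕ} (D : ℤ) : ℕ → (Fin d → ℤ) → Finset (Finset (Fin d → ℤ))
  | 0, z => {{z}}
  | n + 1, z => (nearFinset D z).biUnion fun w => (chains D n w).image (insert z)

theorem card_chains_le {d : ℕ} (D : ℤ) (n : ℕ) (z : Fin d → ℤ) :
    (chains D n z).card ≤ ((2 * D + 1).toNat ^ d) ^ n := by
  induction n generalizing z with
  | zero => simp [chains]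
  | succ n ih =>
    rw [chains]
    refine Finset.card_biUnion_le.trans ?_
    refine (Finset.sum_le_sum fun w _ => Finset.card_image_le.trans (ih w)).trans ?_
    rw [Finset.sum_const, smul_eq_mul, card_nearFinset, pow_succ']

/-- Steps between neighbouring cubes of `T`. -/
def CubeStep {d : ℕ} (T : Set (Fin d → ℤ)) (a b : Fin d → ℤ) : Prop := a ∈ T ∧ b ∈ T ∧ Near 1 a b

/-- Either the walk avoids `B`, or it is cut just after its last visit to `B`; the remainder then
avoids `B`. -/
theorem exists_last_exit {d : ℕ} {T : Set (Fin d → ℤ)} (B : Set (Fin d → ℤ)) {z x : Fin d → ℤ}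
    (h : Relation.ReflTransGen (CubeStep T) z x) (hx : x ∉ B) :
    Relation.ReflTransGen (CubeStep (T \ B)) z x ∧ (z ∈ T → z ∉ B) ∨
      ∃ b ∈ B, ∃ w ∈ T \ B, Near 1 b w ∧ Relation.ReflTransGen (CubeStep (T \ B)) w x := by
  induction h using Relation.ReflTransGen.head_induction_on with
  | refl => exact Or.inl ⟨.refl, fun _ => hx⟩
  | @head a b hab _ ih =>
    rcases ih with ⟨hb, hbB⟩ | h
    · by_cases ha : a ∈ B
      · exact Or.inr ⟨a, ha, b, ⟨hab.2.1, hbB hab.2.1⟩, hab.2.2, hb⟩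
      · exact Or.inl ⟨.head ⟨⟨hab.1, ha⟩, ⟨hab.2.1, hbB hab.2.1⟩, hab.2.2⟩ hb, fun _ => ha⟩
    · exact Or.inr h

/-- After the last exit from the `R`-ball around `z` the walk is at distance at most `R + 1` from
`z` and never returns to the ball. Induction in `T` minus that ball keeps all later cubes separated
from `z`. -/
theorem exists_separated_chain {d : ℕ} {R : ℤ} (hR : 0 ≤ R) (n : ℕ) {T : Set (Fin d → ℤ)}
    {z x : Fin d → ℤ} (hz : z ∈ T) (h : Relation.ReflTransGen (CubeStep T) z x)
    (hfar : ¬ Near (n * (R + 1)) z x) :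
    ∃ S ∈ chains (R + 1) n z, (S : Set (Fin d → ℤ)) ⊆ T ∧ S.card = n + 1 ∧
      (S : Set (Fin d → ℤ)).Pairwise fun a b => ¬ Near R a b := by
  induction n generalizing T z with
  | zero => exact ⟨{z}, by simp [chains], by simpa using hz, by simp, by simp⟩
  | succ n ih =>
    have hx : x ∉ {w | Near R z w} := fun hx => hfar (Near.mono hx (by push_cast; nlinarith))
    rcases exists_last_exit {w | Near R z w} h hx with ⟨-, hzB⟩ | ⟨b, hb, w, hw, hbw, hwx⟩
    · exact absurd (Near.refl hR z) (hzB hz)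
    · have hzw : Near (R + 1) z w := Near.trans hb hbw
      obtain ⟨S, hS, hST, hcard, hsep⟩ := ih hw hwx fun hn =>
        hfar ((hzw.trans hn).mono (by push_cast; linarith))
      have hzS : z ∉ S := fun hzS => (hST hzS).2 (Near.refl hR z)
      refine ⟨insert z S, ?_, ?_, ?_, ?_⟩
      · rw [chains, Finset.mem_biUnion]
        exact ⟨w, mem_nearFinset.2 hzw, Finset.mem_image_of_mem _ hS⟩
      · rw [Finset.coe_insert]
        exact Set.insert_subset hz (hST.trans Set.sdiff_subset)
      · rw [Finset.card_insert_of_notMem hzS, hcard]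
      · rw [Finset.coe_insert]
        exact hsep.insert fun a ha _ => ⟨(hST ha).2, fun hn => (hST ha).2 hn.symm⟩

/-! ### Users -/

/-- The conditional void probabilities of the users. -/
def HasCoxVoids {Ω : Type*} [MeasurableSpace Ω] (P : Measure Ω) {d : ℕ} (lam : ℝ)
    (XS X : Ω → Config d) : Prop :=
  ∀ (k : ℕ) (B : Fin k → Set (Space d)), (∀ i, MeasurableSet (B i)) →
    (∀ i, Bornology.IsBounded (B i)) → Pairwise (Function.onFun Disjoint B) →
    P⟦{ω | ∀ i, (X ω).count (B i) = 0} | MeasurableSpace.comap XS inferInstance⟧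
      =ᵐ[P] fun ω => ∏ i, Real.exp (-(lam * (streetMeasure (XS ω) (B i)).toReal))

/-- Testing no relay set (`l = 0`) removes `p` from the conditional law. -/
theorem IsNetwork.hasCoxVoids {Ω : Type*} [MeasurableSpace Ω] {P : Measure Ω} {d : ℕ}
    {lamS lam p : ℝ} {XS X Y : Ω → Config d} (h : IsNetwork P lamS lam p XS X Y) :
    HasCoxVoids P lam XS X := by
  intro k B hB hb hdis
  have := h.conditional_law k 0 B (fun _ => 0) (fun _ => ∅) (fun _ => 0) hB hb hdis
    (fun j => j.elim0) (fun j => j.elim0) (fun i => i.elim0)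
  simpa [poissonWeight] using this

section users

variable {Ω : Type*} [MeasurableSpace Ω] {P : Measure Ω} {d : ℕ}
  {lam : ℝ} {XS X : Ω → Config d}

theorem HasCoxVoids.finset (h : HasCoxVoids P lam XS X) {ι : Type*} {U : ι → Set (Space d)}
    (hU : ∀ i, MeasurableSet (U i)) (hb : ∀ i, Bornology.IsBounded (U i)) {T : Finset ι}
    (hdis : (T : Set ι).Pairwise (Function.onFun Disjoint U)) :
    P⟦⋂ i ∈ T, X ⁻¹' void (U i) | MeasurableSpace.comap XS inferInstance⟧
      =ᵐ[P] fun ω => ∏ i ∈ T, Real.exp (-(lam * (streetMeasure (XS ω) (U i)).toReal)) := by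
  have e := T.equivFin.symm
  have := h T.card (fun i => U (e i)) (fun i => hU _) (fun i => hb _) fun i j hij =>
    hdis (e i).2 (e j).2 fun hne => hij (e.injective (Subtype.ext hne))
  have hset : {ω | ∀ i, (X ω).count (U (e i)) = 0} = ⋂ i ∈ T, X ⁻¹' void (U i) := by
    ext ω
    simp only [Set.mem_ofPred_eq, Set.mem_iInter, Set.mem_preimage, void]
    exact ⟨fun h i hi => by simpa using h (e.symm ⟨i, hi⟩), fun h i => h _ (e i).2⟩
  rw [hset] at this
  refine this.trans (Filter.Eventually.of_forall fun ω => ?_)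
  beta_reduce
  rw [← Finset.prod_coe_sort T]
  exact e.prod_comp fun i : T => Real.exp (-(lam * (streetMeasure (XS ω) (U i)).toReal))

/-- Given the nuclei, the sets `U i` are hit independently, with probability `1 - exp (-(lam * Λ(U
i)))`, at most `lam * L` on `E`. Only joint void probabilities are known, so the hitting probability
is obtained by inclusion-exclusion, term by term. -/
theorem measure_users_le [IsProbabilityMeasure P] (hXS : Measurable XS) (hX : Measurable X)
    (hlam : 0 ≤ lam)
    (h : HasCoxVoids P lam XS X) {ι : Type*} {U : ι → Set (Space d)}
    (hU : ∀ i, MeasurableSet (U i)) (hb : ∀ i, Bornology.IsBounded (U i)) {S : Finset ι}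
    (hdis : (S : Set ι).Pairwise (Function.onFun Disjoint U)) {E : Set (Config d)}
    (hE : MeasurableSet E) {L : ℝ}
    (hL : ∀ ξ ∈ E, ∀ i ∈ S, (streetMeasure ξ (U i)).toReal ≤ L) :
    P (XS ⁻¹' E ∩ ⋂ i ∈ S, (X ⁻¹' void (U i))ᶜ) ≤
      P (XS ⁻¹' E) * ENNReal.ofReal ((lam * L) ^ S.card) := by
  classical
  have hle : MeasurableSpace.comap XS inferInstance ≤ ‹MeasurableSpace Ω› := hXS.comap_le
  have hEm : MeasurableSet (XS ⁻¹' E) := hXS hE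
  have hvm : ∀ i, MeasurableSet (X ⁻¹' void (U i)) := fun i => hX (measurableSet_void' (hU i))
  have hvT : ∀ T : Finset ι, MeasurableSet (⋂ i ∈ T, X ⁻¹' void (U i)) := fun T =>
    Finset.measurableSet_biInter T fun i _ => hvm i
  set g : ι → Ω → ℝ := fun i ω => Real.exp (-(lam * (streetMeasure (XS ω) (U i)).toReal)) with hg
  set v : ι → Ω → ℝ := fun i => (X ⁻¹' void (U i)).indicator 1 with hv
  have hvprod : ∀ T : Finset ι, (fun ω => ∏ i ∈ T, v i ω) =
      (⋂ i ∈ T, X ⁻¹' void (U i)).indicator fun _ => (1 : ℝ) := by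
    intro T
    ext ω
    simp only [hv, Set.indicator_apply, Pi.one_apply, Set.mem_iInter]
    rw [Finset.prod_ite_zero]
    simp
  have hcond : ∀ T ⊆ S, P⟦⋂ i ∈ T, X ⁻¹' void (U i) | MeasurableSpace.comap XS inferInstance⟧
      =ᵐ[P] fun ω => ∏ i ∈ T, g i ω := fun T hT =>
    h.finset hU hb (hdis.mono (Finset.coe_subset.2 hT))
  have hvint : ∀ T : Finset ι, Integrable (fun ω => ∏ i ∈ T, v i ω) P := fun T => by
    rw [hvprod T]
    exact (integrable_const 1).indicator (hvT T)
  have hgint : ∀ T ⊆ S, Integrable (fun ω => ∏ i ∈ T, g i ω) P := fun T hT =>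
    integrable_condExp.congr (hcond T hT)
  have heq : ∀ T ⊆ S, ∫ ω in XS ⁻¹' E, ∏ i ∈ T, g i ω ∂P = ∫ ω in XS ⁻¹' E, ∏ i ∈ T, v i ω ∂P := by
    intro T hT
    rw [← setIntegral_congr_ae hEm ((hcond T hT).mono fun ω hω _ => hω), hvprod T,
      setIntegral_condExp hle ((integrable_const 1).indicator (hvT T)) ⟨E, hE, rfl⟩]
  have hexp : ∀ f : ι → Ω → ℝ, (fun ω => ∏ i ∈ S, (1 - f i ω)) =
      fun ω => ∑ T ∈ S.powerset, (-1) ^ T.card * ∏ i ∈ T, f i ω := by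
    intro f
    ext ω
    rw [Finset.prod_sub]
    simp
  have hsum : ∀ f : ι → Ω → ℝ, (∀ T ⊆ S, Integrable (fun ω => ∏ i ∈ T, f i ω) P) →
      ∫ ω in XS ⁻¹' E, ∏ i ∈ S, (1 - f i ω) ∂P =
        ∑ T ∈ S.powerset, (-1) ^ T.card * ∫ ω in XS ⁻¹' E, ∏ i ∈ T, f i ω ∂P := by
    intro f hf
    rw [hexp f, integral_finsetSum _ fun T hT =>
      ((hf T (Finset.mem_powerset.1 hT)).integrableOn.const_mul _)]
    exact Finset.sum_congr rfl fun T _ => integral_const_mul _ _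
  have hmain : ∫ ω in XS ⁻¹' E, ∏ i ∈ S, (1 - v i ω) ∂P =
      ∫ ω in XS ⁻¹' E, ∏ i ∈ S, (1 - g i ω) ∂P := by
    rw [hsum v fun T _ => hvint T, hsum g hgint]
    exact Finset.sum_congr rfl fun T hT => by rw [heq T (Finset.mem_powerset.1 hT)]
  have hleft : ∫ ω in XS ⁻¹' E, ∏ i ∈ S, (1 - v i ω) ∂P =
      P.real (XS ⁻¹' E ∩ ⋂ i ∈ S, (X ⁻¹' void (U i))ᶜ) := by
    have h1 : (fun ω => ∏ i ∈ S, (1 - v i ω)) =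
        (⋂ i ∈ S, (X ⁻¹' void (U i))ᶜ).indicator fun _ => (1 : ℝ) := by
      ext ω
      have h2 : ∀ i, 1 - v i ω = if ω ∈ (X ⁻¹' void (U i))ᶜ then 1 else 0 := by
        intro i
        by_cases hi : ω ∈ X ⁻¹' void (U i) <;> simp [hv, hi]
      simp only [h2, Set.indicator_apply, Set.mem_iInter]
      rw [Finset.prod_ite_zero]
      simp
    rw [h1, setIntegral_indicator (Finset.measurableSet_biInter S fun i _ => (hvm i).compl)]
    simp
  have hright : ∫ ω in XS ⁻¹' E, ∏ i ∈ S, (1 - g i ω) ∂P ≤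
      (lam * L) ^ S.card * P.real (XS ⁻¹' E) := by
    have hint : Integrable (fun ω => ∏ i ∈ S, (1 - g i ω)) P := by
      rw [hexp g]
      exact integrable_finsetSum _ fun T hT => (hgint T (Finset.mem_powerset.1 hT)).const_mul _
    calc _ ≤ ∫ _ω in XS ⁻¹' E, (lam * L) ^ S.card ∂P := by
          refine setIntegral_mono_on hint.integrableOn (integrable_const _) hEm fun ω hω => ?_
          rw [← Finset.prod_const]
          refine Finset.prod_le_prod (fun i _ => ?_) fun i hi => ?_
          · rw [sub_nonneg, hg, Real.exp_le_one_iff, neg_nonpos]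
            positivity
          -- This is `1 - exp (-x) ≤ x`.
          · have h1 := Real.add_one_le_exp (-(lam * (streetMeasure (XS ω) (U i)).toReal))
            have h2 := mul_le_mul_of_nonneg_left (hL _ hω i hi) hlam
            simp only [hg]
            linarith
      _ = _ := by rw [setIntegral_const, smul_eq_mul, mul_comm]
  have hfin := (hleft.symm.trans hmain).trans_le hright
  rw [← ENNReal.ofReal_toReal (measure_ne_top P (XS ⁻¹' E ∩ _)),
    ← ENNReal.ofReal_toReal (measure_ne_top P (XS ⁻¹' E)), ← ENNReal.ofReal_mul ENNReal.toReal_nonneg,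
    mul_comm]
  exact ENNReal.ofReal_le_ofReal hfin

end users

/-! ### Bad configurations of nuclei -/

/-- The configurations that have an empty cube around the origin, more than `M` points in the block
of radius `d + 1`, or two simplices there with distinct circumcenters closer than `ρ`. -/
def badNuclei (d M : ℕ) (ρ : ℝ) : Set (Config d) :=
  {ξ | ¬ Occupied 0 ξ} ∪ {ξ | (M : ℕ∞) < ξ.count (block (d + 1) 0)} ∪
    {ξ | ∃ x : Fin (d + 1) ⊕ Fin (d + 1) → Space d,
      (∀ i, x i ∈ ξ.carrier ∧ x i ∈ block (d + 1) 0) ∧ x ∈ closeCenters d ρ}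

theorem setOf_not_occupied (d : ℕ) : {ξ : Config d | ¬ Occupied 0 ξ} =
    ⋃ w ∈ nearFinset 1 (0 : Fin d → ℤ), void (block 0 w) := by
  ext ξ
  simp [Occupied, void, mem_nearFinset]

theorem block_subset_block {d : ℕ} {K L : ℤ} {z w : Fin d → ℤ} (h : Near K z w) :
    (block L w : Set (Space d)) ⊆ block (K + L) z := fun _ hy => h.trans hy

/-- Measurability with respect to a bounded block is the finite range of dependence behind the
independence of distant cubes. -/
theorem measurableSet_badNuclei (d M : ℕ) (ρ : ℝ) :
    MeasurableSet[voidAlgebra (block (d + 1) 0)] (badNuclei d M ρ) := by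
  refine MeasurableSet.union (MeasurableSet.union ?_ ?_) ?_
  · rw [setOf_not_occupied]
    refine Finset.measurableSet_biUnion _ fun w hw => measurableSet_void (measurableSet_block 0 w) ?_
    exact (block_subset_block (mem_nearFinset.1 hw)).trans fun y hy => Near.mono hy (by lia)
  · exact measurableSet_count_preimage (measurableSet_block _ _) subset_rfl (Set.Ioi (M : ℕ∞))
  · exact measurableSet_exists_tuple (measurableSet_block _ _) subset_rfl (isOpen_closeCenters d ρ)

theorem volume_block_zero_pos {d : ℕ} (w : Fin d → ℤ) :
    0 < (volume (block 0 w : Set (Space d))).toReal := by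
  refine ENNReal.toReal_pos ?_ (isBounded_block 0 w).measure_lt_top.ne
  have ho : IsOpen {y : Space d | ∀ i, y i ∈ Set.Ioo (w i : ℝ) (w i + 1)} := by
    rw [Set.ofPred_forall]
    exact isOpen_iInter_of_finite fun i => isOpen_Ioo.preimage (by fun_prop)
  have hne : {y : Space d | ∀ i, y i ∈ Set.Ioo (w i : ℝ) (w i + 1)}.Nonempty :=
    ⟨WithLp.toLp 2 fun i => (w i : ℝ) + 1 / 2, fun i => by
      norm_num⟩
  have hsub : {y : Space d | ∀ i, y i ∈ Set.Ioo (w i : ℝ) (w i + 1)} ⊆ block 0 w := by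
    intro y hy i
    have : ⌊y i⌋ = w i := Int.floor_eq_iff.2 ⟨(hy i).1.le, (hy i).2⟩
    simp [cubeIndex, this]
  exact ((ho.measure_pos volume hne).trans_le (measure_mono hsub)).ne'

/-- Empty cubes become unlikely only through a large intensity, so `μ` is fixed here, by void
probabilities alone and hence uniformly in `Q`. -/
theorem exists_intensity_occupied (d : ℕ) {ε : ℝ≥0∞} (hε : 0 < ε) :
    ∃ μ : ℝ, 0 < μ ∧ ∀ Q : Measure (Config d), HasPoissonVoids Q μ →
      Q {ξ | ¬ Occupied 0 ξ} ≤ ε := by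
  have h : Filter.Tendsto (fun μ : ℝ => ∑ w ∈ nearFinset 1 (0 : Fin d → ℤ),
      ENNReal.ofReal (Real.exp (-(μ * (volume (block 0 w : Set (Space d))).toReal))))
      Filter.atTop (nhds 0) := by
    rw [show (0 : ℝ≥0∞) = ∑ _w ∈ nearFinset 1 (0 : Fin d → ℤ), 0 by simp]
    refine tendsto_finsetSum _ fun w _ => ?_
    rw [← ENNReal.ofReal_zero]
    refine ENNReal.tendsto_ofReal (Real.tendsto_exp_neg_atTop_nhds_zero.comp ?_)
    exact Filter.tendsto_id.atTop_mul_const (volume_block_zero_pos w)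
  obtain ⟨μ, hμ, hμ0⟩ := ((h.eventually_le_const hε).and (Filter.eventually_gt_atTop 0)).exists
  refine ⟨μ, hμ0, fun Q hQ => ?_⟩
  rw [setOf_not_occupied]
  refine (measure_biUnion_finset_le _ _).trans (le_trans (Finset.sum_le_sum fun w _ => ?_) hμ)
  exact (hQ _ (measurableSet_block 0 w) (isBounded_block 0 w)).le

theorem exists_count_bound {d : ℕ} (Q : Measure (Config d)) [IsProbabilityMeasure Q] {ε : ℝ≥0∞}
    (hε : 0 < ε) : ∃ M : ℕ, Q {ξ | (M : ℕ∞) < ξ.count (block (d + 1) 0)} ≤ ε := by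
  have h := tendsto_measure_iInter_atTop (μ := Q)
    (s := fun M : ℕ => {ξ : Config d | (M : ℕ∞) < ξ.count (block (d + 1) 0)})
    (fun M => (voidAlgebra_le _ _ (measurableSet_count_preimage (measurableSet_block _ _)
      subset_rfl (Set.Ioi (M : ℕ∞)))).nullMeasurableSet)
    (fun M N hMN ξ hξ => lt_of_le_of_lt (Nat.cast_le.2 hMN) (Set.mem_ofPred_eq ▸ hξ))
    ⟨0, measure_ne_top _ _⟩
  have h0 : ⋂ M : ℕ, {ξ : Config d | (M : ℕ∞) < ξ.count (block (d + 1) 0)} = ∅ := by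
    refine Set.eq_empty_iff_forall_notMem.2 fun ξ hξ => ?_
    have hfin := ξ.locallyFinite _ (isBounded_block (d + 1) 0)
    have := Set.mem_iInter.1 hξ hfin.toFinset.card
    rw [Set.mem_ofPred_eq, Config.count, hfin.encard_eq_coe_toFinset_card] at this
    exact lt_irrefl _ this
  rw [h0, measure_empty] at h
  exact (h.eventually_le_const hε).exists

/-- A bounded block of a configuration carries finitely many tuples, so its distinct circumcenters
have a positive minimal distance. The events thus decrease to the empty set as `ρ` tends to 0. -/
theorem exists_closeCenters_bound {d : ℕ} (Q : Measure (Config d)) [IsProbabilityMeasure Q]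
    {ε : ℝ≥0∞} (hε : 0 < ε) : ∃ ρ : ℝ, 0 < ρ ∧
      Q {ξ | ∃ x : Fin (d + 1) ⊕ Fin (d + 1) → Space d,
        (∀ i, x i ∈ ξ.carrier ∧ x i ∈ block (d + 1) 0) ∧ x ∈ closeCenters d ρ} ≤ ε := by
  have h := tendsto_measure_iInter_atTop (μ := Q)
    (s := fun n : ℕ => {ξ : Config d | ∃ x : Fin (d + 1) ⊕ Fin (d + 1) → Space d,
        (∀ i, x i ∈ ξ.carrier ∧ x i ∈ block (d + 1) 0) ∧ x ∈ closeCenters d (1 / ((n : ℝ) + 1))})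
    (fun n => (voidAlgebra_le _ _ (measurableSet_exists_tuple (measurableSet_block _ _)
      subset_rfl (isOpen_closeCenters d _))).nullMeasurableSet)
    (fun m n hmn ξ ⟨x, hx, hxc⟩ => ⟨x, hx, hxc.1, hxc.2.1,
      hxc.2.2.trans_le (Nat.one_div_le_one_div hmn)⟩)
    ⟨0, measure_ne_top _ _⟩
  have h0 : ⋂ n : ℕ, {ξ : Config d | ∃ x : Fin (d + 1) ⊕ Fin (d + 1) → Space d,
      (∀ i, x i ∈ ξ.carrier ∧ x i ∈ block (d + 1) 0) ∧
        x ∈ closeCenters d (1 / ((n : ℝ) + 1))} = ∅ := by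
    refine Set.eq_empty_iff_forall_notMem.2 fun ξ hξ => ?_
    have hfin := ξ.locallyFinite _ (isBounded_block (d + 1) 0)
    have hG : {x : Fin (d + 1) ⊕ Fin (d + 1) → Space d |
        ∀ i, x i ∈ ξ.carrier ∧ x i ∈ block (d + 1) 0}.Finite := by
      refine (Set.Finite.pi' fun _ => hfin).subset fun x hx i => hx i
    have hev : ∀ᶠ n : ℕ in Filter.atTop, ∀ x ∈ {x : Fin (d + 1) ⊕ Fin (d + 1) → Space d |
        ∀ i, x i ∈ ξ.carrier ∧ x i ∈ block (d + 1) 0},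
        x ∉ closeCenters d (1 / ((n : ℝ) + 1)) := by
      refine (Filter.eventually_all_finite hG).2 fun x _ => ?_
      by_cases hne : circumcenter (x ∘ Sum.inl) = circumcenter (x ∘ Sum.inr)
      · exact Filter.Eventually.of_forall fun n hx => hx.2.1 hne
      · filter_upwards [tendsto_one_div_add_atTop_nhds_zero_nat.eventually_le_const
          (dist_pos.2 hne)] with n hn hx
        exact absurd hx.2.2 (not_lt.2 hn)
    obtain ⟨n, hn⟩ := hev.exists
    obtain ⟨x, hx, hxc⟩ := Set.mem_iInter.1 hξ n
    exact hn x hx hxc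
  rw [h0, measure_empty] at h
  obtain ⟨n, hn⟩ := (h.eventually_le_const hε).exists
  exact ⟨_, Nat.one_div_pos_of_nat, hn⟩

theorem exists_badNuclei_bound (d : ℕ) {ε : ℝ≥0∞} (hε : 0 < ε) :
    ∃ μ : ℝ, 0 < μ ∧ ∀ Q : Measure (Config d), IsProbabilityMeasure Q → HasPoissonVoids Q μ →
      ∃ (M : ℕ) (ρ : ℝ), 0 < ρ ∧ Q (badNuclei d M ρ) ≤ ε := by
  have h3 : 0 < ε / 3 := ENNReal.div_pos hε.ne' (by simp)
  obtain ⟨μ, hμ, h⟩ := exists_intensity_occupied d h3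
  refine ⟨μ, hμ, fun Q _ hQ => ?_⟩
  obtain ⟨M, hM⟩ := exists_count_bound Q h3
  obtain ⟨ρ, hρ, hc⟩ := exists_closeCenters_bound Q h3
  refine ⟨M, ρ, hρ, ?_⟩
  refine (measure_union_le _ _).trans ((add_le_add ((measure_union_le _ _).trans
    (add_le_add (h Q hQ) hM)) hc).trans_eq ?_)
  exact ENNReal.add_thirds ε

/-! ### Translations to the origin -/

/-- The translation of configurations that moves the cube `z` to the cube at the origin. -/
noncomputable def shift {d : ℕ} (z : Fin d → ℤ) : Config d → Config d :=
  Config.map one_pos (WithLp.toLp 2 fun i => -(z i : ℝ))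

theorem similarity_preimage_block {d : ℕ} (K : ℤ) (z : Fin d → ℤ) :
    similarity 1 one_pos (WithLp.toLp 2 fun i => -(z i : ℝ)) ⁻¹' (block K 0 : Set (Space d)) =
      block K z := by
  ext y
  simp only [block, Near, cubeIndex, Set.mem_preimage, Set.mem_ofPred_eq, similarity_apply]
  refine forall_congr' fun i => ?_
  have : ((1 : ℝ) • y + WithLp.toLp 2 fun i => -(z i : ℝ)) i = y i - z i := by
    simp [sub_eq_add_neg]
  rw [this, Int.floor_sub_intCast, Pi.zero_apply, sub_zero]

theorem measurable_shift {d : ℕ} (K : ℤ) (z : Fin d → ℤ) :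
    Measurable[voidAlgebra (block K z), voidAlgebra (block K 0)] (shift z) := by
  refine @measurable_generateFrom _ _ (voidAlgebra (block K z)) _ _ ?_
  rintro _ ⟨B, hB, -, hBK, rfl⟩
  have : shift z ⁻¹' void B =
      void (similarity 1 one_pos (WithLp.toLp 2 fun i => -(z i : ℝ)) ⁻¹' B) := by
    ext ξ; simp [void, shift, count_map]
  rw [this]
  refine measurableSet_void ((Homeomorph.measurable _) hB) ?_
  rw [← similarity_preimage_block K z]
  exact Set.preimage_mono hBK

theorem HasPoissonVoids.map_shift {d : ℕ} {Q : Measure (Config d)} [IsProbabilityMeasure Q]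
    {μ : ℝ} (h : HasPoissonVoids Q μ) (z : Fin d → ℤ) : Q.map (shift z) = Q := by
  have h1 := h.map one_pos (WithLp.toLp 2 fun i => -(z i : ℝ))
  rw [one_pow, div_one] at h1
  have : IsProbabilityMeasure
      (Q.map (Config.map one_pos (WithLp.toLp 2 fun i => -(z i : ℝ)))) :=
    Measure.isProbabilityMeasure_map (Config.mapEquiv one_pos _).measurable.aemeasurable
  exact h1.unique h

theorem streetMeasure_block_le_of_shift {d M : ℕ} {ρ : ℝ} {z : Fin d → ℤ} {ξ : Config d}
    (h : shift z ξ ∉ badNuclei d M ρ) :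
    (streetMeasure ξ (block 1 z)).toReal ≤ 2 ^ M * (6 * d) := by
  simp only [badNuclei, Set.mem_union, not_or, Set.mem_ofPred_eq, not_not, not_lt] at h
  have := streetMeasure_block_le h.1.1 h.1.2
  rwa [shift, streetMeasure_map _ _ _ (measurableSet_block 1 0), similarity_preimage_block,
    ENNReal.ofReal_one, one_mul] at this

/-- Both crossroads are circumcenters of nondegenerate simplices of nuclei in the larger block; if
they were closer than `ρ`, these simplices would form a pair in `closeCenters`. -/
theorem le_dist_crossroads_of_shift {d M : ℕ} {ρ : ℝ} {z : Fin d → ℤ} {ξ : Config d}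
    (h : shift z ξ ∉ badNuclei d M ρ) {a b : Space d} (ha : a ∈ crossroads ξ)
    (hb : b ∈ crossroads ξ) (haz : a ∈ block 1 z) (hbz : b ∈ block 1 z) (hab : a ≠ b) :
    ρ ≤ dist a b := by
  simp only [badNuclei, Set.mem_union, not_or, Set.mem_ofPred_eq, not_not, not_exists,
    not_and] at h
  set f := similarity 1 one_pos (WithLp.toLp 2 fun i => -(z i : ℝ)) with hf
  have hcr : ∀ y ∈ crossroads ξ, f y ∈ crossroads (shift z ξ) := fun y hy => by
    rw [shift, crossroads_map]; exact Set.mem_image_of_mem _ hy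
  have hbl : ∀ y ∈ block 1 z, f y ∈ block 1 0 := fun y hy => by
    rwa [← similarity_preimage_block] at hy
  obtain ⟨x, hx, hxd, hxc⟩ := exists_simplex_of_mem_crossroads (hcr a ha)
  obtain ⟨y, hy, hyd, hyc⟩ := exists_simplex_of_mem_crossroads (hcr b hb)
  by_contra hlt
  have hne : f a ≠ f b := f.injective.ne hab
  refine h.2 (Sum.elim x y) ?_ ⟨⟨by simpa using hxd, by simpa using hyd⟩, ?_, ?_⟩
  · rintro (i | i)
    · exact ⟨(hx i).1, mem_block_of_mem_nearestNuclei h.1.1 (hbl a haz) (hx i)⟩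
    · exact ⟨(hy i).1, mem_block_of_mem_nearestNuclei h.1.1 (hbl b hbz) (hy i)⟩
  · rw [Sum.elim_comp_inl, Sum.elim_comp_inr, hxc, hyc]
    exact fun heq => hne (PiLp.ext fun i => congrFun heq i)
  · rw [Sum.elim_comp_inl, Sum.elim_comp_inr, hxc, hyc]
    have h1 : dist (f a) (f b) = dist a b := by rw [hf, dist_similarity, one_mul]
    refine lt_of_le_of_lt ?_ (not_le.1 hlt)
    rw [← h1]
    -- `closeCenters` measures in the sup distance, which is at most the Euclidean one.
    exact (dist_pi_le_iff dist_nonneg).2 fun i => abs_coord_sub_le_dist _ _ i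

/-! ### Bad cubes -/

theorem measure_iInter_badNuclei_le {d M : ℕ} {ρ : ℝ} {Q : Measure (Config d)}
    [IsProbabilityMeasure Q] {μ : ℝ} (hQ : HasPoissonVoids Q μ) (S : Finset (Fin d → ℤ))
    (hS : (S : Set (Fin d → ℤ)).Pairwise fun a b => ¬ Near (2 * ((d : ℤ) + 1)) a b) :
    Q (⋂ z ∈ S, shift z ⁻¹' badNuclei d M ρ) ≤ Q (badNuclei d M ρ) ^ S.card := by
  have hind := hQ.iIndep (W := fun z : S => block ((d : ℤ) + 1) z.1) fun a b hab =>
    disjoint_block (hS a.2 b.2 (Subtype.coe_injective.ne hab))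
  have hm : ∀ z, MeasurableSet[voidAlgebra (block ((d : ℤ) + 1) z)]
      (shift z ⁻¹' badNuclei d M ρ) := fun z =>
    measurable_shift _ z (measurableSet_badNuclei d M ρ)
  have h1 : ⋂ z ∈ S, shift z ⁻¹' badNuclei d M ρ =
      ⋂ z : S, shift z.1 ⁻¹' badNuclei d M ρ := by
    ext ξ; simp
  have h2 : ∀ z, Q (shift z ⁻¹' badNuclei d M ρ) = Q (badNuclei d M ρ) := fun z => by
    conv_rhs => rw [← hQ.map_shift z]
    exact ((Config.mapEquiv one_pos _).map_apply _).symm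
  rw [h1, hind.meas_iInter fun z => hm z.1]
  simp [h2]

/-- The cube `z` is bad when the nuclei around it are bad or there is a user nearby. -/
def BadCube {d : ℕ} (M : ℕ) (ρ : ℝ) (ξ users : Config d) (z : Fin d → ℤ) : Prop :=
  shift z ξ ∈ badNuclei d M ρ ∨ users ∉ void (block 1 z)

/-- Split by the set `T` of cubes of `S` whose nuclei are bad: the other cubes must see a user. The
two bounds multiply, and the binomial formula sums them over `T`. -/
theorem measure_badCubes_le {Ω : Type*} [MeasurableSpace Ω] {P : Measure Ω}
    [IsProbabilityMeasure P] {d M : ℕ} {ρ μ lam : ℝ} {XS X : Ω → Config d}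
    (hXS : Measurable XS) (hX : Measurable X) (hlam : 0 ≤ lam) (h : HasCoxVoids P lam XS X)
    (hQ : HasPoissonVoids (P.map XS) μ) (S : Finset (Fin d → ℤ))
    (hS : (S : Set (Fin d → ℤ)).Pairwise fun a b => ¬ Near (2 * ((d : ℤ) + 1)) a b) :
    P {ω | ∀ z ∈ S, BadCube M ρ (XS ω) (X ω) z} ≤
      (P.map XS (badNuclei d M ρ) + ENNReal.ofReal (lam * (2 ^ M * (6 * d)))) ^ S.card := by
  classical
  have := Measure.isProbabilityMeasure_map (μ := P) hXS.aemeasurable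
  set V : (Fin d → ℤ) → Set (Config d) := fun z => shift z ⁻¹' badNuclei d M ρ with hV
  have hVm : ∀ z, MeasurableSet (V z) := fun z => voidAlgebra_le _ _
    (measurable_shift _ z (measurableSet_badNuclei d M ρ))
  set E : Finset (Fin d → ℤ) → Set (Config d) := fun T =>
    (⋂ z ∈ T, V z) ∩ ⋂ z ∈ S \ T, (V z)ᶜ with hE
  have hEm : ∀ T, MeasurableSet (E T) := fun T =>
    (Finset.measurableSet_biInter T fun z _ => hVm z).inter
      (Finset.measurableSet_biInter _ fun z _ => (hVm z).compl)
  have hsub : {ω | ∀ z ∈ S, BadCube M ρ (XS ω) (X ω) z} ⊆ ⋃ T ∈ S.powerset,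
      (XS ⁻¹' E T ∩ ⋂ z ∈ S \ T, (X ⁻¹' void (block 1 z))ᶜ) := by
    intro ω hω
    refine Set.mem_iUnion₂.2 ⟨S.filter fun z => XS ω ∈ V z, by simp, ⟨?_, ?_⟩, ?_⟩
    · exact Set.mem_iInter₂.2 fun z hz => (Finset.mem_filter.1 hz).2
    · refine Set.mem_iInter₂.2 fun z hz hzV => ?_
      rw [Finset.mem_sdiff, Finset.mem_filter, not_and] at hz
      exact hz.2 hz.1 hzV
    · refine Set.mem_iInter₂.2 fun z hz => ?_
      rw [Finset.mem_sdiff, Finset.mem_filter, not_and] at hz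
      exact (hω z hz.1).resolve_left (hz.2 hz.1)
  refine (measure_mono hsub).trans ((measure_biUnion_finset_le _ _).trans ?_)
  rw [← Finset.sum_pow_mul_eq_add_pow]
  refine Finset.sum_le_sum fun T hT => ?_
  have hTS := Finset.mem_powerset.1 hT
  have hdis : ((S \ T : Finset _) : Set (Fin d → ℤ)).Pairwise
      (Function.onFun Disjoint fun z => (block 1 z : Set (Space d))) := fun a ha b hb hab =>
    disjoint_block fun hn => hS (Finset.mem_sdiff.1 ha).1 (Finset.mem_sdiff.1 hb).1 hab
      (hn.mono (by lia))
  refine (measure_users_le hXS hX hlam h (U := fun z => block 1 z) (fun z => measurableSet_block 1 z)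
    (fun z => isBounded_block 1 z) hdis (hEm T) (L := 2 ^ M * (6 * d)) fun ξ hξ z hz =>
      streetMeasure_block_le_of_shift (Set.mem_iInter₂.1 hξ.2 z hz)).trans ?_
  rw [Finset.card_sdiff_of_subset hTS, ENNReal.ofReal_pow (by positivity)]
  refine mul_le_mul' ?_ le_rfl
  rw [← Measure.map_apply hXS (hEm T)]
  exact (measure_mono Set.inter_subset_left).trans
    (measure_iInter_badNuclei_le hQ T (hS.mono (Finset.coe_subset.2 hTS)))

/-- In a good cube `a` and its neighbour `b` cannot be users, so they are two crossroads within `r <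
ρ`. -/
theorem badCube_of_adj {d M : ℕ} {ρ r : ℝ} {ξ users relays : Config d}
    (hY : relays.carrier ⊆ crossroads ξ) (hr : r < ρ) (hr1 : r ≤ 1)
    {a b : ↥(users.carrier ∪ relays.carrier)}
    (hab : (connectivityGraph ξ users relays r).Adj a b) :
    BadCube M ρ ξ users (cubeIndex (a : Space d)) := by
  by_contra hbad
  obtain ⟨hN, hU⟩ := not_or.1 hbad
  have hU' := count_eq_zero.1 (not_not.1 hU)
  have ha : (a : Space d) ∈ block 1 (cubeIndex (a : Space d)) := Near.refl zero_le_one _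
  have hb : (b : Space d) ∈ block 1 (cubeIndex (a : Space d)) :=
    near_cubeIndex_of_dist_le (n := 1) (by simpa using hab.2.2.trans hr1)
  have haY := hY (a.2.resolve_left fun h => hU' _ h ha)
  have hbY := hY (b.2.resolve_left fun h => hU' _ h hb)
  have := le_dist_crossroads_of_shift hN haY hbY ha hb (Subtype.coe_injective.ne hab.1)
  exact absurd (this.trans hab.2.2) (not_le.2 hr)

theorem cubeStep_of_adj {d M : ℕ} {ρ r : ℝ} {ξ users relays : Config d}
    (hY : relays.carrier ⊆ crossroads ξ) (hr : r < ρ) (hr1 : r ≤ 1)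
    {a b : ↥(users.carrier ∪ relays.carrier)}
    (hab : (connectivityGraph ξ users relays r).Adj a b) :
    CubeStep {z | BadCube M ρ ξ users z} (cubeIndex (a : Space d)) (cubeIndex (b : Space d)) :=
  ⟨badCube_of_adj hY hr hr1 hab, badCube_of_adj hY hr hr1 hab.symm,
    near_cubeIndex_of_dist_le (n := 1) (by simpa using hab.2.2.trans hr1)⟩

/-- A vertex in an infinite component starts arbitrarily long separated chains of bad cubes. -/
theorem exists_badChain {d M : ℕ} {ρ r : ℝ} {ξ users relays : Config d}
    (hY : relays.carrier ⊆ crossroads ξ) (hr : r < ρ) (hr1 : r ≤ 1)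
    {c : (connectivityGraph ξ users relays r).ConnectedComponent} (hc : c.supp.Infinite)
    {v : ↥(users.carrier ∪ relays.carrier)} (hv : v ∈ c.supp) {R : ℤ} (hR : 0 ≤ R) (n : ℕ) :
    ∃ S : Finset (Fin d → ℤ), S ∈ chains (R + 1) n (cubeIndex (v : Space d)) ∧
      (∀ z ∈ S, BadCube M ρ ξ users z) ∧ S.card = n + 1 ∧ (S : Set (Fin d → ℤ)).Pairwise fun a b => ¬ Near R a b := by
  -- Local finiteness prevents an infinite component from staying in a bounded block.
  obtain ⟨w, hw, hfar⟩ : ∃ w ∈ c.supp,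
      ¬ Near (n * (R + 1)) (cubeIndex (v : Space d)) (cubeIndex (w : Space d)) := by
    by_contra! hnear
    have hb := isBounded_block (n * (R + 1)) (cubeIndex (v : Space d))
    have hfin := (users.locallyFinite _ hb).union (relays.locallyFinite _ hb)
    refine hc ((hfin.preimage Subtype.coe_injective.injOn).subset fun w hw => ?_)
    rw [← Set.union_inter_distrib_right]
    exact ⟨w.2, hnear w hw⟩
  have hreach : (connectivityGraph ξ users relays r).Reachable v w :=
    SimpleGraph.ConnectedComponent.exact (hv.trans hw.symm)
  have hpath : Relation.ReflTransGen (CubeStep {z | BadCube M ρ ξ users z})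
      (cubeIndex (v : Space d)) (cubeIndex (w : Space d)) :=
    Relation.ReflTransGen.lift (r := (connectivityGraph ξ users relays r).Adj)
      (fun u => cubeIndex (u : Space d)) (fun a b hab => cubeStep_of_adj hY hr hr1 hab) v w
      ((SimpleGraph.reachable_iff_reflTransGen v w).1 hreach)
  have hz : cubeIndex (v : Space d) ∈ {z | BadCube M ρ ξ users z} := by
    rcases hpath.cases_head with heq | ⟨y, hy, -⟩
    · rw [← heq] at hfar
      exact absurd (Near.refl (mul_nonneg n.cast_nonneg (by linarith)) _) hfar
    · exact hy.1
  exact exists_separated_chain hR n hz hpath hfar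

/-- With `C` choices per step, chains of length `n` from a given cube contribute at most `(C * ε) ^
n`, which tends to 0. There are countably many starting cubes. The percolation event is only
included in a null set, so its measurability is not needed. -/
theorem measure_percolates_eq_zero {Ω : Type*} [MeasurableSpace Ω] {P : Measure Ω}
    [IsProbabilityMeasure P] {d M : ℕ} {ρ μ lam r : ℝ} {XS X Y : Ω → Config d}
    (hXS : Measurable XS) (hX : Measurable X) (hlam : 0 ≤ lam) (h : HasCoxVoids P lam XS X)
    (hQ : HasPoissonVoids (P.map XS) μ) (hY : ∀ᵐ ω ∂P, (Y ω).carrier ⊆ crossroads (XS ω))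
    (hr : r < ρ) (hr1 : r ≤ 1) {ε : ℝ≥0∞}
    (hε : P.map XS (badNuclei d M ρ) + ENNReal.ofReal (lam * (2 ^ M * (6 * d))) ≤ ε)
    (hεC : ((2 * (2 * ((d : ℤ) + 1) + 1) + 1).toNat ^ d : ℕ) * ε < 1) (hε1 : ε ≤ 1) :
    P {ω | Percolates (connectivityGraph (XS ω) (X ω) (Y ω) r)} = 0 := by
  set R : ℤ := 2 * ((d : ℤ) + 1) with hR
  set C : ℕ := (2 * (R + 1) + 1).toNat ^ d with hC
  set A : (Fin d → ℤ) → ℕ → Set Ω := fun z n =>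
    {ω | ∃ S : Finset (Fin d → ℤ), S ∈ chains (R + 1) n z ∧
      (∀ z ∈ S, BadCube M ρ (XS ω) (X ω) z) ∧ S.card = n + 1 ∧
      (S : Set (Fin d → ℤ)).Pairwise fun a b => ¬ Near R a b} with hA
  have hAn : ∀ z n, P (A z n) ≤ (C * ε) ^ n := by
    classical
    intro z n
    set F := (chains (R + 1) n z).filter fun S : Finset (Fin d → ℤ) => S.card = n + 1 ∧
      (S : Set (Fin d → ℤ)).Pairwise fun a b => ¬ Near R a b with hF
    have hsub : A z n ⊆ ⋃ S ∈ F, {ω | ∀ z ∈ S, BadCube M ρ (XS ω) (X ω) z} := by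
      rintro ω ⟨S, hS, hbad, hS'⟩
      exact Set.mem_iUnion₂.2 ⟨S, Finset.mem_filter.2 ⟨hS, hS'⟩, hbad⟩
    calc P (A z n) ≤ ∑ S ∈ F, P {ω | ∀ z ∈ S, BadCube M ρ (XS ω) (X ω) z} :=
          (measure_mono hsub).trans (measure_biUnion_finset_le _ _)
      _ ≤ ∑ _S ∈ F, ε ^ n := by
          refine Finset.sum_le_sum fun S hS => ?_
          obtain ⟨-, hcard, hsep⟩ := Finset.mem_filter.1 hS
          refine (measure_badCubes_le hXS hX hlam h hQ S hsep).trans ?_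
          rw [hcard]
          exact (pow_le_pow_left' hε _).trans (pow_le_pow_right_of_le_one' hε1 n.le_succ)
      _ ≤ (C * ε) ^ n := by
          rw [Finset.sum_const, nsmul_eq_mul, mul_pow]
          refine mul_le_mul' ?_ le_rfl
          exact_mod_cast (Finset.card_filter_le _ _).trans (card_chains_le (R + 1) n z)
  have hA0 : ∀ z, P (⋂ n, A z n) = 0 := by
    intro z
    refine le_antisymm ?_ bot_le
    refine ge_of_tendsto' (ENNReal.tendsto_pow_atTop_nhds_zero_of_lt_one hεC) fun n => ?_
    exact (measure_mono (Set.iInter_subset _ n)).trans (hAn z n)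
  refine measure_mono_null (t := {ω | ¬ (Y ω).carrier ⊆ crossroads (XS ω)} ∪ ⋃ z, ⋂ n, A z n) ?_
    (measure_union_null hY (measure_iUnion_null hA0))
  rintro ω ⟨c, hc⟩
  by_cases hYω : (Y ω).carrier ⊆ crossroads (XS ω)
  · obtain ⟨v, hv⟩ := hc.nonempty
    refine Or.inr (Set.mem_iUnion.2 ⟨cubeIndex (v : Space d), Set.mem_iInter.2 fun n => ?_⟩)
    exact exists_badChain hYω hr hr1 hc hv (by positivity) n
  · exact Or.inl hYω

/-! ### Scaling of the network -/

theorem HasCoxVoids.map {Ω : Type*} [MeasurableSpace Ω] {P : Measure Ω} {d : ℕ} {lam b : ℝ}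
    {XS X : Ω → Config d} (h : HasCoxVoids P lam XS X) (hb : 0 < b) (t : Space d) :
    HasCoxVoids P (lam / b) (Config.map hb t ∘ XS) (Config.map hb t ∘ X) := by
  intro k B hB hbd hdis
  have h1 := h k (fun i => similarity b hb t ⁻¹' B i) (fun i => (Homeomorph.measurable _) (hB i))
    (fun i => isBounded_similarity_preimage hb t (hbd i))
    fun i j hij => (hdis hij).preimage _
  -- The similarity acts as a measurable equivalence, so conditioning on the scaled nuclei is the
  -- same as before.
  have hcomap : MeasurableSpace.comap (Config.map hb t ∘ XS) inferInstance =
      MeasurableSpace.comap XS inferInstance := by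
    rw [← MeasurableSpace.comap_comp, ← coe_mapEquiv,
      (Config.mapEquiv hb t).measurableEmbedding.comap_eq]
  rw [hcomap]
  simp only [Function.comp_apply, count_map]
  refine h1.trans (Filter.Eventually.of_forall fun ω => ?_)
  refine Finset.prod_congr rfl fun i _ => ?_
  rw [streetMeasure_map hb t _ (hB i), ENNReal.toReal_mul, ENNReal.toReal_ofReal hb.le,
    ← mul_assoc, div_mul_cancel₀ _ hb.ne']

theorem Percolates.map {V W : Type*} {G : SimpleGraph V} {G' : SimpleGraph W} (h : Percolates G)
    (φ : G →g G') (hφ : Function.Injective φ) : Percolates G' := by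
  obtain ⟨c, hc⟩ := h
  refine ⟨c.map φ, (hc.image hφ.injOn).mono ?_⟩
  rintro _ ⟨v, hv, rfl⟩
  rw [SimpleGraph.ConnectedComponent.mem_supp_iff] at hv ⊢
  rw [← hv]
  rfl

theorem percolates_connectivityGraph_map {d : ℕ} {b r : ℝ} (hb : 0 < b) (t : Space d)
    {ξ users relays : Config d} (h : Percolates (connectivityGraph ξ users relays r)) :
    Percolates (connectivityGraph (ξ.map hb t) (users.map hb t) (relays.map hb t) (b * r)) := by
  refine h.map ⟨fun a => ⟨similarity b hb t a, ?_⟩, ?_⟩ ?_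
  · exact a.2.imp (Set.mem_image_of_mem _) (Set.mem_image_of_mem _)
  · rintro a a' ⟨hne, ⟨e, he, hae, hae'⟩, hr⟩
    refine ⟨fun heq => hne (Subtype.ext ((similarity b hb t).injective (congrArg Subtype.val heq))),
      ⟨similarity b hb t '' e, ?_, Set.mem_image_of_mem _ hae, Set.mem_image_of_mem _ hae'⟩, ?_⟩
    · rw [streets_map]; exact Set.mem_image_of_mem _ he
    · rw [dist_similarity]; exact mul_le_mul_of_nonneg_left hr hb.le
  · exact fun a a' heq => Subtype.ext ((similarity b hb t).injective (congrArg Subtype.val heq))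

/-- Every network can be scaled to any given intensity of nuclei. -/
theorem IsNetwork.exists_scaled {Ω : Type*} [MeasurableSpace Ω] {P : Measure Ω}
    [IsProbabilityMeasure P] {d : ℕ} (hd : d ≠ 0) {lamS lam p r μ : ℝ} {XS X Y : Ω → Config d}
    (hS : 0 < lamS) (hμ : 0 < μ) (h : IsNetwork P lamS lam p XS X Y) :
    ∃ (b : ℝ) (_ : 0 < b) (XS' X' Y' : Ω → Config d), Measurable XS' ∧ Measurable X' ∧
      HasPoissonVoids (P.map XS') μ ∧ HasCoxVoids P (lam / b) XS' X' ∧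
      (∀ᵐ ω ∂P, (Y' ω).carrier ⊆ crossroads (XS' ω)) ∧
      meanStreetLength μ (P.map XS') = b * meanStreetLength lamS (P.map XS) ∧
      ∀ ω, Percolates (connectivityGraph (XS ω) (X ω) (Y ω) r) →
        Percolates (connectivityGraph (XS' ω) (X' ω) (Y' ω) (b * r)) := by
  -- Chosen so that `lamS / b ^ d = μ`.
  set b : ℝ := (lamS / μ) ^ ((d : ℝ)⁻¹) with hbdef
  have hb : 0 < b := Real.rpow_pos_of_pos (div_pos hS hμ) _
  have hbd : lamS / b ^ d = μ := by
    rw [hbdef, Real.rpow_inv_natCast_pow (div_pos hS hμ).le hd]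
    field_simp
  have hm := (Config.mapEquiv hb (0 : Space d)).measurable
  have hXS := h.nuclei.measurable
  have hmap : P.map (Config.map hb 0 ∘ XS) = (P.map XS).map (Config.map hb 0) :=
    (Measure.map_map hm hXS).symm
  refine ⟨b, hb, Config.map hb 0 ∘ XS, Config.map hb 0 ∘ X, Config.map hb 0 ∘ Y, hm.comp hXS,
    hm.comp h.measurable_users, ?_, h.hasCoxVoids.map hb 0, ?_, ?_, fun ω hω =>
      percolates_connectivityGraph_map hb 0 hω⟩
  · rw [hmap, ← hbd]
    exact h.nuclei.hasPoissonVoids.map hb 0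
  · filter_upwards [h.relays_subset] with ω hω
    change _ ⊆ crossroads (Config.map hb 0 (XS ω))
    rw [crossroads_map]
    exact Set.image_mono hω
  · rw [hmap, ← meanStreetLength_map hb hd _ hS, hbd]

end VoronoiPercolation

/-! ### Choice of the thresholds -/

open VoronoiPercolation in
theorem mainTheorem2 (d : ℕ) (hd : 2 ≤ d) :
    ∃ H₀ : ℝ, 0 < H₀ ∧ ∃ U₀ : ℝ, 0 < U₀ ∧
      ∀ H : ℝ, H₀ ≤ H → ∀ U : ℝ, 0 < U → U ≤ U₀ → ∀ p ∈ Set.Icc (0 : ℝ) 1,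
        ∀ {Ω : Type*} [MeasurableSpace Ω] (P : Measure Ω) [IsProbabilityMeasure P]
          (lamS lam r : ℝ) (XS X Y : Ω → VoronoiPercolation.Config d),
          0 < lamS → 0 < lam → 0 < r →
          VoronoiPercolation.IsNetwork P lamS lam p XS X Y →
          U = lam * VoronoiPercolation.meanStreetLength lamS (P.map XS) →
          H = VoronoiPercolation.meanStreetLength lamS (P.map XS) / r →
          P {ω | VoronoiPercolation.Percolates
            (VoronoiPercolation.connectivityGraph (XS ω) (X ω) (Y ω) r)} = 0 := by
  have hd0 : d ≠ 0 := by lia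
  set C : ℕ := (2 * (2 * ((d : ℤ) + 1) + 1) + 1).toNat ^ d with hC
  have hC1 : (1 : ℝ) ≤ C := by
    have : 1 ≤ C := Nat.one_le_pow _ _ (by lia)
    exact_mod_cast this
  -- Nuclei and users are each allowed `1 / (4 * C)`, so a cube costs `1 / (2 * C)` and each chain
  -- step a factor `1 / 2`.
  obtain ⟨μ, hμ, hbad⟩ := exists_badNuclei_bound d (ε := ENNReal.ofReal (1 / (4 * C)))
    (ENNReal.ofReal_pos.2 (by positivity))
  -- `M`, `ρ` and the mean length must come from the law at intensity `μ`, unique if it exists, so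
  -- that they depend on `d` only. Without such a law there is no network, and any thresholds do.
  by_cases hex : ∃ Q : Measure (Config d), IsProbabilityMeasure Q ∧ HasPoissonVoids Q μ
  swap
  · refine ⟨1, one_pos, 1, one_pos, ?_⟩
    intro H _ U _ _ p _ Ω _ P _ lamS lam r XS X Y hS _ _ hnet
    obtain ⟨b, -, XS', -, -, hXS', -, hQ', -⟩ := hnet.exists_scaled (r := r) hd0 hS hμ
    exact absurd ⟨_, Measure.isProbabilityMeasure_map hXS'.aemeasurable, hQ'⟩ hex
  obtain ⟨Q, hQp, hQ⟩ := hex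
  obtain ⟨M, ρ, hρ, hbadM⟩ := hbad Q hQp hQ
  -- Positivity and finiteness of the mean length need no proof: if its real value is 0, including
  -- the value given by `toReal` at infinity, then `U = 0`, contrary to `0 < U`.
  have key : 0 < meanStreetLength μ Q ∨ meanStreetLength μ Q = 0 :=
    (show 0 ≤ meanStreetLength μ Q from ENNReal.toReal_nonneg).lt_or_eq.imp id Eq.symm
  set l := meanStreetLength μ Q with hl
  set r₀ : ℝ := min (ρ / 2) 1 with hr₀
  have hr₀pos : 0 < r₀ := lt_min (half_pos hρ) one_pos
  set L : ℝ := 2 ^ M * (6 * d) with hL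
  have hLpos : 0 < L := by positivity
  have hscaled : ∀ {Ω : Type _} [MeasurableSpace Ω] (P : Measure Ω) [IsProbabilityMeasure P]
      (XS' : Ω → Config d), Measurable XS' → HasPoissonVoids (P.map XS') μ → P.map XS' = Q := by
    intro Ω _ P _ XS' hXS' hQ'
    have := Measure.isProbabilityMeasure_map (μ := P) hXS'.aemeasurable
    exact hQ'.unique hQ
  rcases key with hlpos | hl0
  swap
  · refine ⟨1, one_pos, 1, one_pos, ?_⟩
    intro H _ U hU _ p _ Ω _ P _ lamS lam r XS X Y hS _ _ hnet hUeq
    obtain ⟨b, hb, XS', -, -, hXS', -, hQ', -, -, hmean, -⟩ :=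
      hnet.exists_scaled (r := r) hd0 hS hμ
    rw [hscaled P XS' hXS' hQ', ← hl, hl0] at hmean
    rw [(mul_eq_zero.1 hmean.symm).resolve_left hb.ne', mul_zero] at hUeq
    exact absurd hUeq hU.ne'
  -- In scaled units `H = l / (b * r)` and `U = l * (lam / b)`, so the thresholds say `b * r ≤ r₀`
  -- and `lam / b * L ≤ 1 / (4 * C)`.
  refine ⟨l / r₀, by positivity, l * (1 / (4 * C) / L), by positivity, ?_⟩
  intro H hH U _ hU p _ Ω _ P _ lamS lam r XS X Y hS hlam hr hnet hUeq hHeq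
  obtain ⟨b, hb, XS', X', Y', hXS', hX', hQ', hcox, hY', hmean, hperc⟩ :=
    hnet.exists_scaled (r := r) hd0 hS hμ
  have hlaw := hscaled P XS' hXS' hQ'
  rw [hlaw, ← hl] at hmean
  have hrr : b * r ≤ r₀ := by
    have h1 : H = l / (b * r) := by rw [hHeq, hmean]; field_simp
    rw [h1, div_le_div_iff_of_pos_left hlpos hr₀pos (by positivity)] at hH
    exact hH
  have hlamL : lam / b * L ≤ 1 / (4 * C) := by
    have h1 : U = l * (lam / b) := by rw [hUeq, hmean]; field_simp
    rw [h1] at hU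
    exact (le_div_iff₀ hLpos).1 (le_of_mul_le_mul_left hU hlpos)
  refine measure_mono_null (fun ω hω => hperc ω hω) (measure_percolates_eq_zero (M := M) (ρ := ρ)
    (ε := ENNReal.ofReal (1 / (2 * C))) hXS' hX' (by positivity) hcox hQ' hY' ?_ ?_ ?_ ?_ ?_)
  · exact lt_of_le_of_lt (hrr.trans (min_le_left _ _)) (half_lt_self hρ)
  · exact hrr.trans (min_le_right _ _)
  · rw [hlaw]
    refine (add_le_add hbadM (ENNReal.ofReal_le_ofReal hlamL)).trans_eq ?_
    rw [← ENNReal.ofReal_add (by positivity) (by positivity)]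
    congr 1
    field_simp
    norm_num
  · rw [← hC, ← ENNReal.ofReal_natCast, ← ENNReal.ofReal_mul (by positivity)]
    rw [ENNReal.ofReal_lt_one]
    rw [mul_one_div, div_lt_one (by positivity)]
    linarith
  · rw [ENNReal.ofReal_le_one, div_le_one (by positivity)]
    linarith
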